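/- For $N\ge 2$ let $K_{N,N}$ be the complete bipartite graph on red vertices $1,\dots,N$ and blue vertices $1,\dots,N$. A $k$-factor of $K_{N,N}$ is a spanning subgraph in which every vertex has degree $k$; a matching is a $1$-factor, a $2$-matching is a $2$-factor, and a Hamiltonian cycle is a connected $2$-factor. For real edge weights $w$, the cost of a subgraph is the sum of the weights of its edges, and $E[\mu^*]$, $E[\nu^*]$, $E[h^*]$ denote the minimal costs of a matching, of a $2$-matching and of a Hamiltonian cycle, respectively. (1) For all $N\ge2$ and all real edge weights on $K_{N,N}$ the three minima exist, and $$E[h^*]\;\ge\;E[\nu^*]\;\ge\;2\,E[\mu^*].$$ (2) Let $p>1$, let $r_1,\dots,r_N,b_1,\dots,b_N$ be independent and uniformly distributed in $[0,1]$, and give the edge between the red vertex $i$ and the blue vertex $j$ the weight $|r_i-b_j|^p$. Write a bar with the indices $N,N$ and $(p)$ for the expectation over the points. The three optimal costs are integrable, and there is a constant $E_B^{(p)}\in(0,\infty)$ such that $$\lim_{N\to\infty}\frac{\overline{E^{(p)}_{N,N}[\nu^*]}}{N^{1-p/2}}=\lim_{N\to\infty}\frac{2\,\overline{E^{(p)}_{N,N}[\mu^*]}}{N^{1-p/2}}=\lim_{N\to\infty}\frac{\overline{E^{(p)}_{N,N}[h^*]}}{N^{1-p/2}}=E_B^{(p)}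 .$$ Thus the average optimal cost of the $2$-matching is asymptotically equal to twice that of the matching and to that of the Hamiltonian cycle (the TSP). (3) For $p=2$, $\ \lim_{N\to\infty}\overline{E^{(2)}_{N,N}[\nu^*]}=\tfrac23$. -/

import Mathlib

open MeasureTheory Filter Topology

noncomputable section

namespace TwoMatching

/-- `H` is a `k`-factor of the simple graph `G`: a subgraph of `G` on all the vertices of `G`,
in which every vertex has degree `k`. -/
def IsFactor {V : Type*} (k : ℕ) (G H : SimpleGraph V) : Prop :=
  H ≤ G ∧ ∀ v : V, (H.neighborSet v).encard = k

/-- `H` is a Hamiltonian cycle of `G`: a 2-factor that is formed by a single loop. -/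
def IsHamiltonianCycle {V : Type*} (G H : SimpleGraph V) : Prop :=
  IsFactor 2 G H ∧ H.Connected

open scoped Classical in
/-- The total cost of the edges of `H`. -/
def cost {V : Type*} [Fintype V] (w : Sym2 V → ℝ) (H : SimpleGraph V) : ℝ :=
  ∑ e ∈ H.edgeFinset, w e

/-- The costs of all the `k`-factors of `G`. -/
def factorCosts {V : Type*} [Fintype V] (k : ℕ) (G : SimpleGraph V) (w : Sym2 V → ℝ) : Set ℝ :=
  {c | ∃ H : SimpleGraph V, IsFactor k G H ∧ cost w H = c}

/-- The costs of all the Hamiltonian cycles of `G`. -/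
def hamiltonianCosts {V : Type*} [Fintype V] (G : SimpleGraph V) (w : Sym2 V → ℝ) : Set ℝ :=
  {c | ∃ H : SimpleGraph V, IsHamiltonianCycle G H ∧ cost w H = c}

/-- The cost `E[μ*]` of an optimal matching (1-factor). -/
def matchingCost {V : Type*} [Fintype V] (G : SimpleGraph V) (w : Sym2 V → ℝ) : ℝ :=
  sInf (factorCosts 1 G w)

/-- The cost `E[ν*]` of an optimal 2-matching (2-factor). -/
def twoMatchingCost {V : Type*} [Fintype V] (G : SimpleGraph V) (w : Sym2 V → ℝ) : ℝ :=
  sInf (factorCosts 2 G w)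

/-- The cost `E[h*]` of an optimal Hamiltonian cycle. -/
def tspCost {V : Type*} [Fintype V] (G : SimpleGraph V) (w : Sym2 V → ℝ) : ℝ :=
  sInf (hamiltonianCosts G w)

/-- The vertices of `K_{N,N}`: `Sum.inl i` is the red point `i`, `Sum.inr j` the blue point `j`. -/
abbrev Vertex (N : ℕ) : Type := Fin N ⊕ Fin N

/-- The complete bipartite graph `K_{N,N}`. -/
abbrev K (N : ℕ) : SimpleGraph (Vertex N) := completeBipartiteGraph (Fin N) (Fin N)

/-- The weights `|x_u - x_v| ^ p` of the edges when vertex `v` sits at the point `x v` of the line. -/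
def weight {V : Type*} (p : ℝ) (x : V → ℝ) : Sym2 V → ℝ :=
  Sym2.lift ⟨fun u v => |x u - x v| ^ p, fun u v => by simp only [abs_sub_comm]⟩

/-- The law of the points: independent and uniform in `[0,1]`. -/
def law (N : ℕ) : Measure (Vertex N → ℝ) :=
  Measure.pi fun _ => (volume : Measure ℝ).restrict (Set.Icc 0 1)

/-- The average cost of the optimal matching on `K_{N,N}`. -/
def avgMatching (p : ℝ) (N : ℕ) : ℝ := ∫ x, matchingCost (K N) (weight p x) ∂law N

/-- The average cost of the optimal 2-matching on `K_{N,N}`. -/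
def avgTwoMatching (p : ℝ) (N : ℕ) : ℝ := ∫ x, twoMatchingCost (K N) (weight p x) ∂law N

/-- The average cost of the optimal Hamiltonian cycle on `K_{N,N}`. -/
def avgTSP (p : ℝ) (N : ℕ) : ℝ := ∫ x, tspCost (K N) (weight p x) ∂law N

end TwoMatching

end

/-! The lower bounds hold for all weights. By Hall's theorem a bipartite 2-factor splits into two
perfect matchings, each costing at least the optimal one, and a Hamiltonian cycle is a 2-factor
(`two_mul_matchingCost_le`, `twoMatchingCost_le_tspCost`). The limits therefore need two more facts:
a Hamiltonian cycle that costs asymptotically no more than twice the optimal matching, and the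
asymptotics of the matching itself.

The cycle. Since `|x| ^ p` is convex, matching the sorted points in order is optimal
(`matchingCost_weight`). A zigzag joins the `k`-th red point to the blue points `k + 1` and `k - 1`;
such an edge is at most as long as the `k`-th matching edge plus a gap between consecutive blue
points. Convexity with a parameter `t` separates the two contributions: the matching gets a factor
`(1 - t) ^ (1 - p)`, the gaps get `t ^ (1 - p)` (`tspCost_le`). The gaps are of order `1 / N`, so
their `p`-th powers sum to `O(N ^ (1 - p))` on average (`lintegral_gapSum_le`). With `t = N ^
(-1/2)` the gap term is smaller than the scale `N ^ (1 - p / 2)` by a factor `N ^ (-1/2)`, while the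
factor of the matching tends to 1.

The matching. The sorted matching joins points of equal rank. The density of "rank `m` at position
`s`" is binomial, so the expected cost is a sum over `m` of squared binomial coefficients times
two-variable Selberg integrals. Integration by parts evaluates these, and Chu-Vandermonde sums them
to the exact value `exactMatching`. Euler's limit for `Γ` then gives the constant `2 * Γ(1 + p / 2)
/ (p + 1)`, which is `2 / 3` at `p = 2`. -/

noncomputable section

namespace TwoMatching

/-! ### Bipartite graphs as relations -/

/-- The bipartite graph in which red `i` and blue `j` are adjacent when `R i j`. -/
def ofRel {N : ℕ} (R : Fin N → Fin N → Prop) : SimpleGraph (Vertex N) where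
  Adj u v := match u, v with
    | Sum.inl i, Sum.inr j => R i j
    | Sum.inr j, Sum.inl i => R i j
    | _, _ => False
  symm := ⟨by rintro (i | i) (j | j) h <;> exact h⟩
  loopless := ⟨by rintro (i | i) h <;> exact h⟩

variable {N : ℕ}

@[simp] lemma ofRel_inl_inr (R : Fin N → Fin N → Prop) (i j : Fin N) :
    (ofRel R).Adj (Sum.inl i) (Sum.inr j) ↔ R i j := Iff.rfl

@[simp] lemma ofRel_inr_inl (R : Fin N → Fin N → Prop) (i j : Fin N) :
    (ofRel R).Adj (Sum.inr j) (Sum.inl i) ↔ R i j := Iff.rfl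

@[simp] lemma ofRel_inl_inl (R : Fin N → Fin N → Prop) (i j : Fin N) :
    ¬ (ofRel R).Adj (Sum.inl i) (Sum.inl j) := fun h => h

@[simp] lemma ofRel_inr_inr (R : Fin N → Fin N → Prop) (i j : Fin N) :
    ¬ (ofRel R).Adj (Sum.inr i) (Sum.inr j) := fun h => h

lemma ofRel_le (R : Fin N → Fin N → Prop) : ofRel R ≤ K N := by
  rintro (i | i) (j | j) h
  · exact h.elim
  · simp
  · simp
  · exact h.elim

lemma eq_ofRel {H : SimpleGraph (Vertex N)} (hH : H ≤ K N) :
    H = ofRel fun i j => H.Adj (Sum.inl i) (Sum.inr j) := by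
  ext u v
  rcases u with i | i <;> rcases v with j | j
  · simp only [ofRel_inl_inl, iff_false]
    intro h
    simpa using hH h
  · simp
  · simp [H.adj_comm]
  · simp only [ofRel_inr_inr, iff_false]
    intro h
    simpa using hH h

open scoped Classical in
lemma cost_ofRel (w : Sym2 (Vertex N) → ℝ) (R : Fin N → Fin N → Prop) :
    cost w (ofRel R) = ∑ i, ∑ j, if R i j then w s(Sum.inl i, Sum.inr j) else 0 := by
  have himg : (ofRel R).edgeFinset =
      ((Finset.univ : Finset (Fin N × Fin N)).filter fun q => R q.1 q.2).image
        fun q => s(Sum.inl q.1, Sum.inr q.2) := by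
    ext e
    induction e using Sym2.ind with
    | _ u v =>
      rcases u with i | i <;> rcases v with j | j <;> simp
  rw [cost, himg, Finset.sum_image, Finset.sum_filter, Fintype.sum_prod_type]
  rintro ⟨i, j⟩ - ⟨i', j'⟩ - h
  simpa using h

open scoped Classical in
lemma isFactor_ofRel {k : ℕ} {R : Fin N → Fin N → Prop} :
    IsFactor k (K N) (ofRel R) ↔
      (∀ i, (Finset.univ.filter fun j => R i j).card = k) ∧
      (∀ j, (Finset.univ.filter fun i => R i j).card = k) := by
  have hl (i : Fin N) : ((ofRel R).neighborSet (Sum.inl i)).encard =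
      (Finset.univ.filter fun j => R i j).card := by
    rw [← Set.encard_coe_eq_coe_finsetCard,
      ← (Sum.inr_injective (α := Fin N) (β := Fin N)).encard_image]
    congr 1
    ext v
    rcases v with j | j <;> simp
  have hr (j : Fin N) : ((ofRel R).neighborSet (Sum.inr j)).encard =
      (Finset.univ.filter fun i => R i j).card := by
    rw [← Set.encard_coe_eq_coe_finsetCard,
      ← (Sum.inl_injective (α := Fin N) (β := Fin N)).encard_image]
    congr 1
    ext v
    rcases v with i | i <;> simp
  simp only [IsFactor, ofRel_le, true_and, Sum.forall, hl, hr, Nat.cast_inj]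

/-! ### Matchings are permutations -/

/-- The cost of the matching that joins red `i` to blue `σ i`. -/
def permCost (w : Sym2 (Vertex N) → ℝ) (σ : Equiv.Perm (Fin N)) : ℝ :=
  ∑ i, w s(Sum.inl i, Sum.inr (σ i))

lemma cost_ofRel_perm (w : Sym2 (Vertex N) → ℝ) (σ : Equiv.Perm (Fin N)) :
    cost w (ofRel fun i j => σ i = j) = permCost w σ := by
  rw [cost_ofRel, permCost]
  refine Finset.sum_congr rfl fun i _ => ?_
  rw [Finset.sum_eq_single (σ i)] <;> simp +contextual [eq_comm]

lemma isFactor_ofRel_perm (σ : Equiv.Perm (Fin N)) :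
    IsFactor 1 (K N) (ofRel fun i j => σ i = j) := by
  classical
  refine isFactor_ofRel.2 ⟨fun i => ?_, fun j => ?_⟩
  · exact Finset.card_eq_one.2 ⟨σ i, by ext; simp [eq_comm]⟩
  · exact Finset.card_eq_one.2 ⟨σ.symm j, by ext; simp [Equiv.eq_symm_apply]⟩

open scoped Classical in
lemma exists_perm_of_card_eq_one {R : Fin N → Fin N → Prop}
    (h₁ : ∀ i, (Finset.univ.filter fun j => R i j).card = 1)
    (h₂ : ∀ j, (Finset.univ.filter fun i => R i j).card = 1) :
    ∃ σ : Equiv.Perm (Fin N), R = fun i j => σ i = j := by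
  simp only [Finset.card_eq_one, Finset.ext_iff, Finset.mem_filter, Finset.mem_univ, true_and,
    Finset.mem_singleton] at h₁ h₂
  choose f hf using h₁
  choose g hg using h₂
  refine ⟨⟨f, g, fun i => ?_, fun j => ?_⟩, ?_⟩
  · exact ((hg _ _).1 ((hf _ _).2 rfl)).symm
  · exact ((hf _ _).1 ((hg _ _).2 rfl)).symm
  · ext i j
    exact (hf i j).trans eq_comm

lemma factorCosts_one (w : Sym2 (Vertex N) → ℝ) :
    factorCosts 1 (K N) w = Set.range (permCost w) := by
  classical
  ext c
  constructor
  · rintro ⟨H, hH, rfl⟩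
    obtain ⟨R, rfl⟩ : ∃ R, H = ofRel R := ⟨_, eq_ofRel hH.1⟩
    obtain ⟨h₁, h₂⟩ := isFactor_ofRel.1 hH
    obtain ⟨σ, hσ⟩ := exists_perm_of_card_eq_one h₁ h₂
    exact ⟨σ, by rw [hσ, cost_ofRel_perm]⟩
  · rintro ⟨σ, rfl⟩
    exact ⟨_, isFactor_ofRel_perm σ, cost_ofRel_perm w σ⟩

/-- A bipartite 2-factor is the disjoint union of two matchings. -/
lemma exists_perm_perm_of_mem_factorCosts_two {w : Sym2 (Vertex N) → ℝ} {c : ℝ}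
    (hc : c ∈ factorCosts 2 (K N) w) :
    ∃ σ τ : Equiv.Perm (Fin N), c = permCost w σ + permCost w τ := by
  classical
  obtain ⟨H, hH, rfl⟩ := hc
  obtain ⟨R, rfl⟩ : ∃ R, H = ofRel R := ⟨_, eq_ofRel hH.1⟩
  obtain ⟨h₁, h₂⟩ := isFactor_ofRel.1 hH
  -- Hall's condition by double counting: `2 * s.card` edges leave `s`, and a vertex of its
  -- neighbourhood receives at most two of them.
  have hall : ∃ f : Fin N → Fin N, Function.Injective f ∧
      ∀ i, f i ∈ Finset.univ.filter fun j => R i j := by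
    refine (Finset.all_card_le_biUnion_card_iff_exists_injective _).1 fun s => ?_
    refine Nat.le_of_mul_le_mul_right (Finset.card_mul_le_card_mul R (m := 2) (n := 2) ?_ ?_)
      two_pos
    · intro i hi
      rw [← h₁ i]
      refine Finset.card_le_card fun j hj => ?_
      rw [Finset.mem_bipartiteAbove]
      exact ⟨Finset.mem_biUnion.2 ⟨i, hi, hj⟩, (Finset.mem_filter.1 hj).2⟩
    · intro j _
      rw [← h₂ j]
      refine Finset.card_le_card fun i hi => ?_
      simpa using (Finset.mem_bipartiteBelow _).1 hi |>.2
  obtain ⟨f, hf, hR⟩ := hall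
  set σ : Equiv.Perm (Fin N) := Equiv.ofBijective f (Finite.injective_iff_bijective.1 hf)
  replace hR (i : Fin N) : R i (σ i) := (Finset.mem_filter.1 (hR i)).2
  -- Deleting the edges of `σ` lowers every degree from 2 to 1, so the remainder is again a
  -- matching.
  obtain ⟨τ, hτ⟩ := exists_perm_of_card_eq_one (R := fun i j => R i j ∧ j ≠ σ i)
    (fun i => by
      trans ((Finset.univ.filter fun j => R i j).erase (σ i)).card
      · congr 1
        ext j
        simp [and_comm]
      · rw [Finset.card_erase_of_mem (by simpa using hR i), h₁])
    (fun j => by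
      trans ((Finset.univ.filter fun i => R i j).erase (σ.symm j)).card
      · congr 1
        ext i
        simp [and_comm, Equiv.eq_symm_apply, eq_comm]
      · rw [Finset.card_erase_of_mem (by simpa using hR (σ.symm j)), h₂])
  refine ⟨σ, τ, ?_⟩
  rw [cost_ofRel, ← cost_ofRel_perm, ← cost_ofRel_perm, cost_ofRel, cost_ofRel,
    ← Finset.sum_add_distrib]
  refine Finset.sum_congr rfl fun i _ => ?_
  rw [← Finset.sum_add_distrib]
  refine Finset.sum_congr rfl fun j _ => ?_
  have h : (R i j ∧ j ≠ σ i) = (τ i = j) := congrFun₂ hτ i j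
  by_cases hj : σ i = j
  · have : R i j := hj ▸ hR i
    simp [← h, hj, this]
  · simp [← h, hj, Ne.symm hj]

/-! ### A Hamiltonian cycle that zigzags through the points -/

/-- In the zigzag, red `k` is adjacent to blue `k + 1` and `k - 1`, with the obvious exceptions
at the two ends. -/
def zigzagNext (k : Fin N) : Fin N := ⟨min (k + 1) (N - 1), by have := k.2; omega⟩

/-- The other neighbour in the zigzag. -/
def zigzagPrev (k : Fin N) : Fin N := ⟨k - 1, by have := k.2; omega⟩

/-- The zigzag, when the `k`-th red point is `ρ k` and the `k`-th blue one is `β k`. -/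
def zigzag (ρ β : Equiv.Perm (Fin N)) : SimpleGraph (Vertex N) :=
  ofRel fun i j => β.symm j = zigzagNext (ρ.symm i) ∨ β.symm j = zigzagPrev (ρ.symm i)

/-- This is where `2 ≤ N` enters: for `N = 1` both neighbours are 0 and the degree drops to 1. -/
lemma zigzagNext_ne_zigzagPrev (hN : 2 ≤ N) (k : Fin N) : zigzagNext k ≠ zigzagPrev k := by
  have := k.2
  simp only [zigzagNext, zigzagPrev, ne_eq, Fin.mk.injEq]
  omega

/-- The adjacency is symmetric in the two colours, so the blue degrees follow from the count for the
red ones. -/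
lemma zigzag_symm (k l : Fin N) :
    l = zigzagNext k ∨ l = zigzagPrev k ↔ k = zigzagNext l ∨ k = zigzagPrev l := by
  have := k.2
  have := l.2
  simp only [zigzagNext, zigzagPrev, Fin.ext_iff]
  omega

lemma card_zigzag (hN : 2 ≤ N) (β : Equiv.Perm (Fin N)) (k : Fin N) :
    (Finset.univ.filter fun j => β.symm j = zigzagNext k ∨ β.symm j = zigzagPrev k).card = 2 := by
  classical
  rw [show (Finset.univ.filter fun j => β.symm j = zigzagNext k ∨ β.symm j = zigzagPrev k) =
    {β (zigzagNext k), β (zigzagPrev k)} by ext j; simp [Equiv.symm_apply_eq]]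
  exact Finset.card_pair (β.injective.ne (zigzagNext_ne_zigzagPrev hN k))

lemma isHamiltonianCycle_zigzag (hN : 2 ≤ N) (ρ β : Equiv.Perm (Fin N)) :
    IsHamiltonianCycle (K N) (zigzag ρ β) := by
  classical
  refine ⟨isFactor_ofRel.2 ⟨fun i => ?_, fun j => ?_⟩, ?_⟩
  · convert card_zigzag hN β (ρ.symm i)
  · simp only [zigzag_symm (ρ.symm _)]
    convert card_zigzag hN ρ (β.symm j)
  -- Two strands leave the first red point, one through blue 0 and one through blue 1. Each step `k
  -- → k + 1` prolongs both, with the colours exchanged.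
  · have key (k : ℕ) (hk : k < N) :
        (zigzag ρ β).Reachable (Sum.inl (ρ ⟨0, by omega⟩)) (Sum.inl (ρ ⟨k, hk⟩)) ∧
        (zigzag ρ β).Reachable (Sum.inl (ρ ⟨0, by omega⟩)) (Sum.inr (β ⟨k, hk⟩)) := by
      induction k with
      | zero =>
        refine ⟨SimpleGraph.Reachable.refl _, SimpleGraph.Adj.reachable ?_⟩
        simp [zigzag, zigzagPrev]
      | succ k ih =>
        obtain ⟨h₁, h₂⟩ := ih (by omega)
        refine ⟨h₂.trans (SimpleGraph.Adj.reachable ?_), h₁.trans (SimpleGraph.Adj.reachable ?_)⟩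
        · simp [zigzag, zigzagPrev]
        · simp only [zigzag, zigzagNext, ofRel_inl_inr, Equiv.symm_apply_apply, Fin.mk.injEq]
          omega
    rw [SimpleGraph.connected_iff_exists_forall_reachable]
    refine ⟨Sum.inl (ρ ⟨0, by omega⟩), ?_⟩
    rintro (i | j)
    · simpa using (key (ρ.symm i) (ρ.symm i).2).1
    · simpa using (key (β.symm j) (β.symm j).2).2

lemma cost_zigzag (hN : 2 ≤ N) (w : Sym2 (Vertex N) → ℝ) (ρ β : Equiv.Perm (Fin N)) :
    cost w (zigzag ρ β) = ∑ k, (w s(Sum.inl (ρ k), Sum.inr (β (zigzagNext k))) +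
      w s(Sum.inl (ρ k), Sum.inr (β (zigzagPrev k)))) := by
  classical
  rw [zigzag, cost_ofRel, ← Equiv.sum_comp ρ]
  refine Finset.sum_congr rfl fun k _ => ?_
  rw [← Equiv.sum_comp β]
  simp only [Equiv.symm_apply_apply]
  rw [← Finset.sum_filter, show (Finset.univ.filter fun l => l = zigzagNext k ∨ l = zigzagPrev k) =
    {zigzagNext k, zigzagPrev k} by ext; simp]
  exact Finset.sum_pair (zigzagNext_ne_zigzagPrev hN k)

/-! ### Existence of the optima, and the sandwich -/

lemma finite_factorCosts {V : Type*} [Fintype V] (k : ℕ) (G : SimpleGraph V) (w : Sym2 V → ℝ) :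
    (factorCosts k G w).Finite := by
  refine (Set.finite_range (cost w)).subset ?_
  rintro c ⟨H, -, rfl⟩
  exact ⟨H, rfl⟩

lemma hamiltonianCosts_subset {V : Type*} [Fintype V] (G : SimpleGraph V) (w : Sym2 V → ℝ) :
    hamiltonianCosts G w ⊆ factorCosts 2 G w := fun _ ⟨H, h, hc⟩ => ⟨H, h.1, hc⟩

lemma finite_hamiltonianCosts {V : Type*} [Fintype V] (G : SimpleGraph V) (w : Sym2 V → ℝ) :
    (hamiltonianCosts G w).Finite :=
  (finite_factorCosts 2 G w).subset (hamiltonianCosts_subset G w)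

lemma isLeast_csInf {s : Set ℝ} (hs : s.Finite) (hne : s.Nonempty) : IsLeast s (sInf s) :=
  ⟨hne.csInf_mem hs, fun _ => csInf_le hs.bddBelow⟩

lemma isLeast_matchingCost (w : Sym2 (Vertex N) → ℝ) :
    IsLeast (factorCosts 1 (K N) w) (matchingCost (K N) w) :=
  isLeast_csInf (finite_factorCosts 1 _ w) (factorCosts_one w ▸ Set.range_nonempty _)

lemma hamiltonianCosts_nonempty (hN : 2 ≤ N) (w : Sym2 (Vertex N) → ℝ) :
    (hamiltonianCosts (K N) w).Nonempty :=
  ⟨_, zigzag 1 1, isHamiltonianCycle_zigzag hN 1 1, rfl⟩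

lemma isLeast_tspCost (hN : 2 ≤ N) (w : Sym2 (Vertex N) → ℝ) :
    IsLeast (hamiltonianCosts (K N) w) (tspCost (K N) w) :=
  isLeast_csInf (finite_hamiltonianCosts _ w) (hamiltonianCosts_nonempty hN w)

lemma isLeast_twoMatchingCost (hN : 2 ≤ N) (w : Sym2 (Vertex N) → ℝ) :
    IsLeast (factorCosts 2 (K N) w) (twoMatchingCost (K N) w) :=
  isLeast_csInf (finite_factorCosts 2 _ w)
    ((hamiltonianCosts_nonempty hN w).mono (hamiltonianCosts_subset _ w))

lemma matchingCost_le (w : Sym2 (Vertex N) → ℝ) (σ : Equiv.Perm (Fin N)) :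
    matchingCost (K N) w ≤ permCost w σ :=
  (isLeast_matchingCost w).2 (factorCosts_one w ▸ Set.mem_range_self σ)

lemma twoMatchingCost_le_tspCost (hN : 2 ≤ N) (w : Sym2 (Vertex N) → ℝ) :
    twoMatchingCost (K N) w ≤ tspCost (K N) w :=
  (isLeast_twoMatchingCost hN w).2 (hamiltonianCosts_subset _ w (isLeast_tspCost hN w).1)

lemma two_mul_matchingCost_le (hN : 2 ≤ N) (w : Sym2 (Vertex N) → ℝ) :
    2 * matchingCost (K N) w ≤ twoMatchingCost (K N) w := by
  obtain ⟨σ, τ, h⟩ := exists_perm_perm_of_mem_factorCosts_two (isLeast_twoMatchingCost hN w).1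
  rw [h, two_mul]
  exact add_le_add (matchingCost_le w σ) (matchingCost_le w τ)

/-! ### Rearrangement: the sorted matching is optimal -/

/-- For a Monge array the identity is an optimal assignment. -/
lemma sum_le_sum_perm_of_monge {ι : Type*} [LinearOrder ι] {c : ι → ι → ℝ}
    (hc : ∀ ⦃i i' j j'⦄, i ≤ i' → j ≤ j' → c i j + c i' j' ≤ c i j' + c i' j)
    (s : Finset ι) {σ : Equiv.Perm ι} (hσ : {x | σ x ≠ x} ⊆ s) :
    ∑ i ∈ s, c i i ≤ ∑ i ∈ s, c i (σ i) := by
  induction s using Finset.induction_on_max generalizing σ with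
  | empty => simp
  | insert a s hmax ih =>
    have has : a ∉ s := fun h => (hmax a h).false
    have hmem : ∀ x, σ x ≠ x → x ≠ a → x ∈ s := fun x hx hxa =>
      Finset.mem_of_mem_insert_of_ne (Finset.mem_coe.1 (hσ hx)) hxa
    -- Uncrossing at the largest index: `τ` fixes `a` and sends `σ.symm a` to `σ a`. The Monge
    -- inequality for `σ.symm a ≤ a` and `σ a ≤ a` shows that this does not raise the cost, and `τ`
    -- moves only elements of `s`.
    set τ : Equiv.Perm ι := σ.trans (Equiv.swap a (σ a)) with hτ
    have hτs : {x | τ x ≠ x} ⊆ (s : Set ι) := by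
      intro x hx
      have hx' : τ x ≠ x := hx
      have hxa : x ≠ a := by
        rintro rfl
        exact hx' (by simp [τ])
      refine Finset.mem_coe.2 (hmem x (fun h => hx' ?_) hxa)
      simp only [τ, Equiv.trans_apply, h]
      exact Equiv.swap_apply_of_ne_of_ne hxa fun h' => hxa (σ.injective (h.trans h'))
    rw [Finset.sum_insert has, Finset.sum_insert has]
    refine (add_le_add_right (ih hτs) _).trans ?_
    obtain hσa | hσa := eq_or_ne (σ a) a
    · simp [hτ, hσa]
    have hsa : σ.symm a ≠ a := fun h => hσa (by rw [← h, Equiv.apply_symm_apply, h])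
    have h1s : σ.symm a ∈ s := hmem _ (by rw [Equiv.apply_symm_apply]; exact hsa.symm) hsa
    have h2s : σ a ∈ s := hmem _ (σ.injective.ne hσa) hσa
    rw [← Finset.sum_erase_add _ _ h1s, ← Finset.sum_erase_add _ _ h1s]
    have key := hc (hmax _ h1s).le (hmax _ h2s).le
    have hsum : ∑ x ∈ s.erase (σ.symm a), c x (τ x) = ∑ x ∈ s.erase (σ.symm a), c x (σ x) := by
      refine Finset.sum_congr rfl fun x hx => ?_
      rw [Finset.mem_erase, ne_eq, Equiv.eq_symm_apply] at hx
      simp only [τ, Equiv.trans_apply]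
      rw [Equiv.swap_apply_of_ne_of_ne hx.1 (σ.injective.ne fun h => has (by rw [← h]; exact hx.2))]
    have hτ' : τ (σ.symm a) = σ a := by simp [τ]
    rw [hsum, hτ', Equiv.apply_symm_apply]
    linarith

lemma convexOn_abs_rpow {p : ℝ} (hp : 1 ≤ p) : ConvexOn ℝ Set.univ fun x : ℝ => |x| ^ p := by
  refine ⟨convex_univ, fun x _ y _ a b ha hb hab => ?_⟩
  refine le_trans ?_ ((convexOn_rpow hp).2 (abs_nonneg x) (abs_nonneg y) ha hb hab)
  refine Real.rpow_le_rpow (abs_nonneg _) ?_ (by linarith)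
  simp only [smul_eq_mul]
  refine (abs_add_le _ _).trans ?_
  rw [abs_mul, abs_mul, abs_of_nonneg ha, abs_of_nonneg hb]

/-- Both `d` and `e` are convex combinations of `l` and `u`, with the two weights interchanged;
adding the two convexity inequalities makes the weights sum to 1. -/
lemma _root_.ConvexOn.add_le_add_of_mem_Icc {φ : ℝ → ℝ} (hφ : ConvexOn ℝ Set.univ φ) {l u d e : ℝ}
    (hl : l ≤ d) (hu : d ≤ u) (h : d + e = l + u) : φ d + φ e ≤ φ l + φ u := by
  obtain rfl | hlu := (hl.trans hu).eq_or_lt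
  · obtain rfl : d = l := le_antisymm hu hl
    obtain rfl : e = d := by linarith
    rfl
  have hpos : 0 < u - l := sub_pos.2 hlu
  have ht : 0 ≤ (u - d) / (u - l) := div_nonneg (sub_nonneg.2 hu) hpos.le
  have hs : 0 ≤ (d - l) / (u - l) := div_nonneg (sub_nonneg.2 hl) hpos.le
  have hts : (u - d) / (u - l) + (d - l) / (u - l) = 1 := by field_simp; ring
  have h₁ := hφ.2 (Set.mem_univ l) (Set.mem_univ u) ht hs hts
  have h₂ := hφ.2 (Set.mem_univ l) (Set.mem_univ u) hs ht (by rw [add_comm]; exact hts)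
  have e₁ : ((u - d) / (u - l)) • l + ((d - l) / (u - l)) • u = d := by
    simp only [smul_eq_mul]; field_simp; ring
  have e₂ : ((d - l) / (u - l)) • l + ((u - d) / (u - l)) • u = e := by
    rw [show e = l + u - d by linarith]; simp only [smul_eq_mul]; field_simp; ring
  rw [e₁] at h₁
  rw [e₂] at h₂
  have h₃ := congrArg (· * φ l) hts
  have h₄ := congrArg (· * φ u) hts
  simp only [smul_eq_mul] at h₁ h₂ h₃ h₄
  linarith

/-- The two pairs of differences have the same sum, and the uncrossed differences lie between the
crossed ones `x - y'` and `x' - y`. -/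
lemma abs_sub_rpow_monge {p : ℝ} (hp : 1 ≤ p) {x x' y y' : ℝ} (hx : x ≤ x') (hy : y ≤ y') :
    |x - y| ^ p + |x' - y'| ^ p ≤ |x - y'| ^ p + |x' - y| ^ p :=
  (convexOn_abs_rpow hp).add_le_add_of_mem_Icc (l := x - y') (u := x' - y) (d := x - y)
    (e := x' - y') (by linarith) (by linarith) (by ring)

/-- The points of one colour in increasing order. -/
def sorted (b : Fin N → ℝ) : Fin N → ℝ := b ∘ Tuple.sort b

lemma sorted_monotone (b : Fin N → ℝ) : Monotone (sorted b) := Tuple.monotone_sort b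

lemma sorted_strictMono {b : Fin N → ℝ} (hb : Function.Injective b) : StrictMono (sorted b) :=
  (sorted_monotone b).strictMono_of_injective (hb.comp (Tuple.sort b).injective)

/-- The cost of the matching of the sorted points. -/
def sortedCost (p : ℝ) (r b : Fin N → ℝ) : ℝ := ∑ k, |sorted r k - sorted b k| ^ p

lemma weight_mk {V : Type*} (p : ℝ) (x : V → ℝ) (u v : V) :
    weight p x s(u, v) = |x u - x v| ^ p := rfl

lemma permCost_weight_sort (p : ℝ) (x : Vertex N → ℝ) :
    permCost (weight p x) ((Tuple.sort fun i => x (Sum.inl i)).symm.trans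
      (Tuple.sort fun j => x (Sum.inr j))) =
    sortedCost p (fun i => x (Sum.inl i)) (fun j => x (Sum.inr j)) := by
  rw [permCost, sortedCost, ← Equiv.sum_comp (Tuple.sort fun i => x (Sum.inl i))]
  simp [weight_mk, sorted]

lemma matchingCost_weight {p : ℝ} (hp : 1 ≤ p) (x : Vertex N → ℝ) :
    matchingCost (K N) (weight p x) =
      sortedCost p (fun i => x (Sum.inl i)) (fun j => x (Sum.inr j)) := by
  refine le_antisymm (permCost_weight_sort p x ▸ matchingCost_le _ _) ?_
  obtain ⟨σ, hσ⟩ := factorCosts_one (weight p x) ▸ (isLeast_matchingCost (weight p x)).1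
  rw [← hσ, permCost, ← Equiv.sum_comp (Tuple.sort fun i => x (Sum.inl i))]
  have h := sum_le_sum_perm_of_monge
    (c := fun k l => |sorted (fun i => x (Sum.inl i)) k - sorted (fun j => x (Sum.inr j)) l| ^ p)
    (fun i i' j j' hi hj => abs_sub_rpow_monge hp (sorted_monotone _ hi) (sorted_monotone _ hj))
    Finset.univ (σ := ((Tuple.sort fun i => x (Sum.inl i)).trans σ).trans
      (Tuple.sort fun j => x (Sum.inr j)).symm) (by simp)
  refine h.trans_eq (Finset.sum_congr rfl fun k _ => ?_)
  simp [weight_mk, sorted]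

/-! ### The upper bound for the Hamiltonian cycle -/

/-- Convexity applied to `a + g = (1 - t) * (a / (1 - t)) + t * (g / t)`. The coefficient of `a ^ p`
tends to 1 as `t → 0`, which keeps the leading constant sharp. -/
lemma add_rpow_le_of_lt_one {p t : ℝ} (hp : 1 ≤ p) (h0 : 0 < t) (h1 : t < 1) {a g : ℝ}
    (ha : 0 ≤ a) (hg : 0 ≤ g) :
    (a + g) ^ p ≤ (1 - t) ^ (1 - p) * a ^ p + t ^ (1 - p) * g ^ p := by
  have ht : 0 < 1 - t := by linarith
  have h := (convexOn_rpow hp).2 (x := a / (1 - t)) (div_nonneg ha ht.le)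
    (y := g / t) (div_nonneg hg h0.le) ht.le h0.le (by ring)
  simp only [smul_eq_mul] at h
  rw [mul_div_cancel₀ _ ht.ne', mul_div_cancel₀ _ h0.ne', Real.div_rpow ha ht.le,
    Real.div_rpow hg h0.le] at h
  refine h.trans_eq ?_
  rw [Real.rpow_sub ht, Real.rpow_sub h0, Real.rpow_one, Real.rpow_one]
  ring

lemma abs_sub_rpow_le {p t : ℝ} (hp : 1 ≤ p) (h0 : 0 < t) (h1 : t < 1) (x y z : ℝ) :
    |x - z| ^ p ≤ (1 - t) ^ (1 - p) * |x - y| ^ p + t ^ (1 - p) * |y - z| ^ p :=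
  (Real.rpow_le_rpow (abs_nonneg _) (abs_sub_le x y z) (by linarith)).trans
    (add_rpow_le_of_lt_one hp h0 h1 (abs_nonneg _) (abs_nonneg _))

open scoped Classical in
/-- The `p`-th power of the gap from point `i` to point `j`, if they are neighbours. -/
def gap {ι : Type*} (p : ℝ) (b : ι → ℝ) (i j : ι) : ℝ :=
  if b i < b j ∧ ∀ l, ¬ (b i < b l ∧ b l < b j) then |b i - b j| ^ p else 0

lemma gap_nonneg {ι : Type*} (p : ℝ) (b : ι → ℝ) (i j : ι) : 0 ≤ gap p b i j := by
  unfold gap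
  split_ifs
  exacts [by positivity, le_rfl]

/-- The sum of the `p`-th powers of all the gaps. -/
def gapSum (p : ℝ) (b : Fin N → ℝ) : ℝ := ∑ i, ∑ j, gap p b i j

/-- Sorting merely relabels the pairs. The unsorted form suits the expectation, the sorted form the
zigzag. -/
lemma gapSum_eq (p : ℝ) (b : Fin N → ℝ) : gapSum p b = ∑ k, ∑ l, gap p (sorted b) k l := by
  rw [gapSum, ← Equiv.sum_comp (Tuple.sort b)]
  refine Finset.sum_congr rfl fun k _ => ?_
  rw [← Equiv.sum_comp (Tuple.sort b)]
  refine Finset.sum_congr rfl fun l _ => ?_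
  simp only [gap, sorted, Function.comp_apply]
  congr 2
  exact propext ⟨fun h m => h _, fun h m => by simpa using h ((Tuple.sort b).symm m)⟩

lemma gap_of_strictMono {p : ℝ} {s : Fin N → ℝ} (hs : StrictMono s) {k l : Fin N}
    (h : (l : ℕ) = k + 1) : gap p s k l = |s k - s l| ^ p := by
  rw [gap, if_pos]
  refine ⟨hs (by rw [Fin.lt_def]; omega), fun m => ?_⟩
  rw [hs.lt_iff_lt, hs.lt_iff_lt, Fin.lt_def, Fin.lt_def]
  omega

lemma abs_sub_zigzagNext_le {p : ℝ} (hp : 0 < p) {s : Fin N → ℝ} (hs : StrictMono s) (k : Fin N) :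
    |s k - s (zigzagNext k)| ^ p ≤ ∑ l, gap p s k l := by
  by_cases h : (zigzagNext k : ℕ) = k + 1
  · rw [← gap_of_strictMono hs h]
    exact Finset.single_le_sum (fun l _ => gap_nonneg p s k l) (Finset.mem_univ _)
  -- At the right end the zigzag uses the matching edge itself, so no gap is needed.
  · have h' : zigzagNext k = k := by
      have := k.2
      simp only [zigzagNext, Fin.ext_iff] at h ⊢
      omega
    rw [h', sub_self, abs_zero, Real.zero_rpow hp.ne']
    exact Finset.sum_nonneg fun l _ => gap_nonneg p s k l

lemma abs_sub_zigzagPrev_le {p : ℝ} (hp : 0 < p) {s : Fin N → ℝ} (hs : StrictMono s) (k : Fin N) :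
    |s k - s (zigzagPrev k)| ^ p ≤ ∑ l, gap p s l k := by
  by_cases h : (k : ℕ) = zigzagPrev k + 1
  · rw [abs_sub_comm, ← gap_of_strictMono hs h]
    exact Finset.single_le_sum (f := fun l => gap p s l k) (fun l _ => gap_nonneg p s l k)
      (Finset.mem_univ _)
  · have h' : zigzagPrev k = k := by
      have := k.2
      simp only [zigzagPrev, Fin.ext_iff] at h ⊢
      omega
    rw [h', sub_self, abs_zero, Real.zero_rpow hp.ne']
    exact Finset.sum_nonneg fun l _ => gap_nonneg p s l k

/-- The edges of the zigzag at the `k`-th red point are compared with the detour through the `k`-th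
blue point. Each gap is used once by `zigzagNext` and once by `zigzagPrev`, whence the factors 2. -/
lemma tspCost_le {p t : ℝ} (hp : 1 < p) (h0 : 0 < t) (h1 : t < 1) (hN : 2 ≤ N)
    {x : Vertex N → ℝ} (hx : Function.Injective x) :
    tspCost (K N) (weight p x) ≤
      (1 - t) ^ (1 - p) * (2 * matchingCost (K N) (weight p x)) +
        t ^ (1 - p) * (2 * gapSum p fun j => x (Sum.inr j)) := by
  set r : Fin N → ℝ := fun i => x (Sum.inl i)
  set b : Fin N → ℝ := fun j => x (Sum.inr j)
  have hb : StrictMono (sorted b) := sorted_strictMono (hx.comp Sum.inr_injective)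
  have ht : 0 ≤ t ^ (1 - p) := by positivity
  refine ((isLeast_tspCost hN (weight p x)).2
    ⟨_, isHamiltonianCycle_zigzag hN (Tuple.sort r) (Tuple.sort b), rfl⟩).trans ?_
  rw [cost_zigzag hN, matchingCost_weight hp.le, gapSum_eq, sortedCost, Finset.sum_add_distrib]
  have hnext : ∑ k, weight p x s(Sum.inl (Tuple.sort r k), Sum.inr (Tuple.sort b (zigzagNext k))) ≤
      (1 - t) ^ (1 - p) * ∑ k, |sorted r k - sorted b k| ^ p +
        t ^ (1 - p) * ∑ k, ∑ l, gap p (sorted b) k l := by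
    rw [Finset.mul_sum, Finset.mul_sum, ← Finset.sum_add_distrib]
    refine Finset.sum_le_sum fun k _ => ?_
    refine (abs_sub_rpow_le hp.le h0 h1 (sorted r k) (sorted b k)
      (sorted b (zigzagNext k))).trans ?_
    gcongr
    exact abs_sub_zigzagNext_le (by linarith) hb k
  have hprev : ∑ k, weight p x s(Sum.inl (Tuple.sort r k), Sum.inr (Tuple.sort b (zigzagPrev k))) ≤
      (1 - t) ^ (1 - p) * ∑ k, |sorted r k - sorted b k| ^ p +
        t ^ (1 - p) * ∑ k, ∑ l, gap p (sorted b) k l := by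
    -- Here a gap is attributed to its right end, hence the exchange of the sums.
    rw [Finset.sum_comm (f := fun k l => gap p (sorted b) k l), Finset.mul_sum, Finset.mul_sum,
      ← Finset.sum_add_distrib]
    refine Finset.sum_le_sum fun k _ => ?_
    refine (abs_sub_rpow_le hp.le h0 h1 (sorted r k) (sorted b k)
      (sorted b (zigzagPrev k))).trans ?_
    gcongr
    exact abs_sub_zigzagPrev_le (by linarith) hb k
  linarith

/-! ### The sorted matching in terms of ranks -/

/-- The number of points to the left of point `i`. -/
def rank {ι : Type*} [Fintype ι] (b : ι → ℝ) (i : ι) : ℕ :=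
  (Finset.univ.filter fun l => b l < b i).card

lemma rank_sort {b : Fin N → ℝ} (hb : Function.Injective b) (k : Fin N) :
    rank b (Tuple.sort b k) = k := by
  have h := sorted_strictMono hb
  rw [rank, ← Fin.card_Iio k, ← Finset.card_map (s := Finset.Iio k) (Tuple.sort b).toEmbedding]
  congr 1
  ext l
  simp only [Finset.mem_filter, Finset.mem_univ, true_and, Finset.mem_map_equiv, Finset.mem_Iio]
  rw [← h.lt_iff_lt]
  simp [sorted]

/-- This eliminates the sorting permutations: each summand involves one point of each colour and
their ranks, so its expectation can be computed by itself. -/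
lemma sortedCost_eq_sum_rank (p : ℝ) {r b : Fin N → ℝ} (hr : Function.Injective r)
    (hb : Function.Injective b) :
    sortedCost p r b = ∑ i, ∑ j, if rank r i = rank b j then |r i - b j| ^ p else 0 := by
  rw [sortedCost, eq_comm, ← Equiv.sum_comp (Tuple.sort r)]
  refine Finset.sum_congr rfl fun k _ => ?_
  rw [← Equiv.sum_comp (Tuple.sort b), Finset.sum_eq_single k]
  · simp [rank_sort hr, rank_sort hb, sorted]
  · intro l _ hl
    rw [if_neg]
    rw [rank_sort hr, rank_sort hb, ← Fin.ext_iff]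
    exact hl.symm
  · simp

/-! ### A two-dimensional Selberg integral -/

/-- The integral over the unit square, as an iterated integral. -/
def sq (f : ℝ → ℝ → ℝ) : ℝ := ∫ y in (0 : ℝ)..1, ∫ x in (0 : ℝ)..1, f x y

lemma continuous_inner {f : ℝ → ℝ → ℝ} (hf : Continuous fun q : ℝ × ℝ => f q.1 q.2) :
    Continuous fun y => ∫ x in (0 : ℝ)..1, f x y :=
  intervalIntegral.continuous_parametric_intervalIntegral_of_continuous'
    (f := fun y x => f x y) (by exact hf.comp continuous_swap) 0 1

lemma sq_add {f g : ℝ → ℝ → ℝ} (hf : Continuous fun q : ℝ × ℝ => f q.1 q.2)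
    (hg : Continuous fun q : ℝ × ℝ => g q.1 q.2) :
    sq (fun x y => f x y + g x y) = sq f + sq g := by
  unfold sq
  rw [← intervalIntegral.integral_add ((continuous_inner hf).intervalIntegrable _ _)
    ((continuous_inner hg).intervalIntegrable _ _)]
  congr 1
  ext y
  exact intervalIntegral.integral_add ((by fun_prop : Continuous fun x => f x y).intervalIntegrable _ _)
    ((by fun_prop : Continuous fun x => g x y).intervalIntegrable _ _)

lemma sq_const_mul (c : ℝ) (f : ℝ → ℝ → ℝ) : sq (fun x y => c * f x y) = c * sq f := by
  simp [sq, intervalIntegral.integral_const_mul]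

lemma sq_swap {f : ℝ → ℝ → ℝ} (hf : Continuous fun q : ℝ × ℝ => f q.1 q.2) :
    sq (fun x y => f y x) = sq f := by
  unfold sq
  refine intervalIntegral_intervalIntegral_swap ?_
  refine (hf.continuousOn.integrableOn_compact
    ((isCompact_uIcc (a := (0 : ℝ)) (b := 1)).prod
      (isCompact_uIcc (a := (0 : ℝ)) (b := 1)))).mono_set ?_
  exact Set.prod_mono Set.uIoc_subset_uIcc Set.uIoc_subset_uIcc

/-- For `1 < p < 2` the factor `|d| ^ (p - 2)` is unbounded near 0; continuity is read off from `|x|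
^ p` being continuously differentiable. -/
lemma continuous_deriv_abs_rpow {p : ℝ} (hp : 1 < p) :
    Continuous fun d : ℝ => p * |d| ^ (p - 2) * d := by
  have h : deriv (fun x : ℝ => |x| ^ p) = fun d : ℝ => p * |d| ^ (p - 2) * d :=
    funext fun d => (hasDerivAt_abs_rpow d hp).deriv
  rw [← h]
  exact (contDiff_norm_rpow (E := ℝ) hp).continuous_deriv le_rfl

lemma continuous_abs_rpow {p : ℝ} (hp : 0 ≤ p) : Continuous fun d : ℝ => |d| ^ p :=
  continuous_abs.rpow_const fun _ => Or.inr hp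

lemma abs_rpow_sub_two_mul {p : ℝ} (hp : 0 < p) (d : ℝ) :
    p * |d| ^ (p - 2) * d * d = p * |d| ^ p := by
  obtain rfl | hd := eq_or_ne d 0
  · simp [hp.ne']
  · rw [Real.rpow_sub (abs_pos.2 hd), Real.rpow_two, sq_abs]
    field_simp

/-- The integrand of the Selberg integral. -/
def selbergFun (p : ℝ) (a b : ℕ) (x y : ℝ) : ℝ :=
  x ^ a * (1 - x) ^ b * (y ^ a * (1 - y) ^ b) * |x - y| ^ p

/-- The Selberg integral. -/
def selberg (p : ℝ) (a b : ℕ) : ℝ := sq (selbergFun p a b)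

/-- The integrand is the derivative of `x ^ (a + 1) * (1 - x) ^ (b + 1) * |x - y| ^ p`, which
vanishes at 0 and 1. -/
lemma integral_selberg_by_parts {p : ℝ} (hp : 1 < p) (a b : ℕ) (y : ℝ) :
    ∫ x in (0 : ℝ)..1, (((a + 1) * (1 - x) - (b + 1) * x) * (x ^ a * (1 - x) ^ b) * |x - y| ^ p +
      x ^ (a + 1) * (1 - x) ^ (b + 1) * (p * |x - y| ^ (p - 2) * (x - y))) = 0 := by
  have hc := continuous_deriv_abs_rpow hp
  have hc' := continuous_abs_rpow (p := p) (by linarith)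
  rw [intervalIntegral.integral_eq_sub_of_hasDerivAt
    (f := fun x => x ^ (a + 1) * (1 - x) ^ (b + 1) * |x - y| ^ p)]
  · simp
  · intro x _
    have h1 : HasDerivAt (fun x : ℝ => |x - y| ^ p) (p * |x - y| ^ (p - 2) * (x - y)) x := by
      exact (hasDerivAt_abs_rpow (x - y) hp).comp_sub_const x y
    have h2 : HasDerivAt (fun x : ℝ => x ^ (a + 1)) ((a + 1) * x ^ a) x := by
      simpa using hasDerivAt_pow (a + 1) x
    have h3 : HasDerivAt (fun x : ℝ => (1 - x) ^ (b + 1)) (-((b + 1) * (1 - x) ^ b)) x := by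
      simpa [Function.comp_def] using (hasDerivAt_pow (b + 1) (1 - x)).comp_const_sub 1 x
    convert! (h2.mul h3).mul h1 using 1
    simp only [Pi.mul_apply]
    ring
  · refine Continuous.intervalIntegrable ?_ _ _
    have h1 : Continuous fun x : ℝ => |x - y| ^ p := hc'.comp (continuous_id.sub continuous_const)
    have h2 : Continuous fun x : ℝ => p * |x - y| ^ (p - 2) * (x - y) :=
      hc.comp (continuous_id.sub continuous_const)
    exact ((by fun_prop : Continuous fun x : ℝ =>
      ((a + 1) * (1 - x) - (b + 1) * x) * (x ^ a * (1 - x) ^ b)).mul h1).add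
      ((by fun_prop : Continuous fun x : ℝ => x ^ (a + 1) * (1 - x) ^ (b + 1)).mul h2)

/-- Integration by parts against a weight `u y`, symmetrized. -/
lemma sq_selberg_by_parts {p : ℝ} (hp : 1 < p) (a b : ℕ) {u : ℝ → ℝ} (hu : Continuous u) :
    sq (fun x y => ((u y * ((a + 1) * (1 - x) - (b + 1) * x) +
        u x * ((a + 1) * (1 - y) - (b + 1) * y)) * |x - y| ^ p +
      (u y * (x * (1 - x)) - u x * (y * (1 - y))) * (p * |x - y| ^ (p - 2) * (x - y))) *
      (x ^ a * (1 - x) ^ b * (y ^ a * (1 - y) ^ b))) = 0 := by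
  set F : ℝ → ℝ → ℝ := fun x y => u y * (y ^ a * (1 - y) ^ b) *
    (((a + 1) * (1 - x) - (b + 1) * x) * (x ^ a * (1 - x) ^ b) * |x - y| ^ p +
      x ^ (a + 1) * (1 - x) ^ (b + 1) * (p * |x - y| ^ (p - 2) * (x - y))) with hF
  have hFc : Continuous fun q : ℝ × ℝ => F q.1 q.2 := by
    have h1 : Continuous fun q : ℝ × ℝ => |q.1 - q.2| ^ p :=
      (continuous_abs_rpow (p := p) (by linarith)).comp (continuous_fst.sub continuous_snd)
    have h2 : Continuous fun q : ℝ × ℝ => p * |q.1 - q.2| ^ (p - 2) * (q.1 - q.2) :=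
      (continuous_deriv_abs_rpow hp).comp (continuous_fst.sub continuous_snd)
    exact (by fun_prop : Continuous fun q : ℝ × ℝ => u q.2 * (q.2 ^ a * (1 - q.2) ^ b)).mul
      (((by fun_prop : Continuous fun q : ℝ × ℝ =>
        ((a + 1) * (1 - q.1) - (b + 1) * q.1) * (q.1 ^ a * (1 - q.1) ^ b)).mul h1).add
      ((by fun_prop : Continuous fun q : ℝ × ℝ => q.1 ^ (a + 1) * (1 - q.1) ^ (b + 1)).mul h2))
  have h0 : sq F = 0 := by
    simp [sq, hF, integral_selberg_by_parts hp]
  -- Adding the transpose makes the odd factor `x - y` meet a difference that vanishes for `x = y`,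
  -- so that the derivative term can be turned back into `|x - y| ^ p`.
  have h := sq_add (g := fun x y => F y x) hFc (hFc.comp continuous_swap)
  rw [sq_swap hFc, h0, add_zero] at h
  rw [← h]
  congr 1
  ext x y
  simp only [hF, abs_sub_comm y x]
  ring

lemma continuous_selbergFun {p : ℝ} (hp : 1 < p) (a b : ℕ) :
    Continuous fun q : ℝ × ℝ => selbergFun p a b q.1 q.2 := by
  have h1 : Continuous fun q : ℝ × ℝ => |q.1 - q.2| ^ p :=
    (continuous_abs_rpow (p := p) (by linarith)).comp (continuous_fst.sub continuous_snd)
  exact (by fun_prop : Continuous fun q : ℝ × ℝ =>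
    q.1 ^ a * (1 - q.1) ^ b * (q.2 ^ a * (1 - q.2) ^ b)).mul h1

/-- The weights `u = 1` and `u = y` give two linear relations among `selberg p a b`, `selberg p (a +
1) b` and the moment `M` of `x + y`; eliminating `M` leaves the recurrence. The brackets factor as
`(x - y) * (1 - x - y)` and `-(x * y) * (x - y)`. -/
lemma selberg_recurrence {p : ℝ} (hp : 1 < p) (a b : ℕ) :
    (a + b + 2 + p) * (a + b + 2 + p / 2) * selberg p (a + 1) b =
      (a + 1 + p / 2) * (a + 1) * selberg p a b := by
  have hs := continuous_selbergFun hp a b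
  have hx : Continuous fun q : ℝ × ℝ => (q.1 + q.2) * selbergFun p a b q.1 q.2 :=
    (continuous_fst.add continuous_snd).mul hs
  have hs' := continuous_selbergFun hp (a + 1) b
  set M := sq fun x y => (x + y) * selbergFun p a b x y with hM
  have e1 : (2 * (a + 1) + p) * selberg p a b + -(a + b + 2 + p) * M = 0 := by
    rw [← sq_selberg_by_parts hp a b (u := fun _ => 1) continuous_const, selberg, hM,
      ← sq_const_mul, ← sq_const_mul, ← sq_add (continuous_const.mul hs) (continuous_const.mul hx)]
    congr 1
    ext x y
    have := abs_rpow_sub_two_mul (p := p) (by linarith) (x - y)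
    simp only [selbergFun]
    linear_combination -(1 - x - y) * (x ^ a * (1 - x) ^ b * (y ^ a * (1 - y) ^ b)) * this
  have e2 : (a + 1) * M + -(2 * (a + b + 2) + p) * selberg p (a + 1) b = 0 := by
    rw [← sq_selberg_by_parts hp a b (u := fun y => y) continuous_id, selberg, hM,
      ← sq_const_mul, ← sq_const_mul, ← sq_add (continuous_const.mul hx) (continuous_const.mul hs')]
    congr 1
    ext x y
    have := abs_rpow_sub_two_mul (p := p) (by linarith) (x - y)
    simp only [selbergFun]
    linear_combination (x * y) * (x ^ a * (1 - x) ^ b * (y ^ a * (1 - y) ^ b)) * this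
  linear_combination (-(a + 1) / 2) * e1 - (a + b + 2 + p) / 2 * e2

lemma selberg_comm (p : ℝ) (a b : ℕ) : selberg p a b = selberg p b a := by
  have h (g : ℝ → ℝ) : ∫ x in (0 : ℝ)..1, g (1 - x) = ∫ x in (0 : ℝ)..1, g x := by
    simp
  rw [selberg, selberg, sq, sq, ← h]
  congr 1
  ext y
  rw [← h]
  congr 1
  ext x
  simp only [selbergFun, sub_sub_cancel]
  rw [sub_sub_sub_cancel_left, abs_sub_comm y x]
  ring

lemma selberg_zero_zero {p : ℝ} (hp : 1 < p) : selberg p 0 0 = 2 / ((p + 1) * (p + 2)) := by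
  have hp1 : p + 1 ≠ 0 := by linarith
  have hp2 : p + 2 ≠ 0 := by linarith
  have hc' := continuous_abs_rpow (p := p) (by linarith)
  have inner (y : ℝ) : ∫ x in (0 : ℝ)..1, |x - y| ^ p =
      (|1 - y| ^ p * (1 - y) + |y| ^ p * y) / (p + 1) := by
    rw [intervalIntegral.integral_eq_sub_of_hasDerivAt
      (f := fun x => |x - y| ^ p * (x - y) / (p + 1))]
    · simp only [zero_sub, abs_neg]
      ring
    · intro x _
      have h1 : HasDerivAt (fun x : ℝ => |x - y| ^ p) (p * |x - y| ^ (p - 2) * (x - y)) x := by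
        exact (hasDerivAt_abs_rpow (x - y) hp).comp_sub_const x y
      convert! (h1.mul ((hasDerivAt_id x).sub_const y)).div_const (p + 1) using 1
      rw [eq_div_iff hp1]
      have := abs_rpow_sub_two_mul (p := p) (by linarith) (x - y)
      simp only [id]
      linear_combination -this
    · exact (hc'.comp (continuous_id.sub continuous_const)).intervalIntegrable _ _
  have outer : ∫ y in (0 : ℝ)..1, |y| ^ p * y = 1 / (p + 2) := by
    rw [intervalIntegral.integral_eq_sub_of_hasDerivAt (f := fun x => |x| ^ (p + 2) / (p + 2))]
    · simp [Real.zero_rpow hp2]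
    · intro x _
      convert! (hasDerivAt_abs_rpow x (p := p + 2) (by linarith)).div_const (p + 2) using 1
      rw [add_sub_cancel_right]
      field_simp
    · exact (hc'.mul continuous_id).intervalIntegrable _ _
  have outer' : ∫ y in (0 : ℝ)..1, |1 - y| ^ p * (1 - y) = 1 / (p + 2) := by
    rw [← outer, intervalIntegral.integral_comp_sub_left (fun y => |y| ^ p * y)]
    simp
  have hc1 : Continuous fun y : ℝ => |1 - y| ^ p * (1 - y) :=
    (hc'.comp (continuous_const.sub continuous_id)).mul (continuous_const.sub continuous_id)
  have hc2 : Continuous fun y : ℝ => |y| ^ p * y := hc'.mul continuous_id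
  simp only [selberg, sq, selbergFun, pow_zero, one_mul, mul_one, inner]
  rw [intervalIntegral.integral_div, intervalIntegral.integral_add (hc1.intervalIntegrable _ _)
    (hc2.intervalIntegrable _ _), outer, outer']
  field_simp
  norm_num

/-! ### Summation of the Selberg integrals -/

/-- The rising factorial `c (c + 1) ⋯ (c + n - 1)`. -/
def rising (c : ℝ) (n : ℕ) : ℝ := ∏ j ∈ Finset.range n, (c + j)

lemma rising_succ (c : ℝ) (n : ℕ) : rising c (n + 1) = rising c n * (c + n) :=
  Finset.prod_range_succ _ _

lemma rising_succ' (c : ℝ) (n : ℕ) : rising c (n + 1) = c * rising (c + 1) n := by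
  rw [rising, Finset.prod_range_succ', mul_comm, rising]
  congr 1
  · simp
  · refine Finset.prod_congr rfl fun j _ => ?_
    push_cast
    ring

lemma rising_pos {c : ℝ} (hc : 0 < c) (n : ℕ) : 0 < rising c n :=
  Finset.prod_pos fun _ _ => by positivity

/-- The Chu-Vandermonde identity for equal parameters. -/
lemma sum_antidiagonal_rising (c : ℝ) (n : ℕ) :
    ∑ q ∈ Finset.HasAntidiagonal.antidiagonal n,
      rising c q.1 / q.1.factorial * (rising c q.2 / q.2.factorial) =
    rising (2 * c) n / n.factorial := by
  set f : ℕ → ℝ := fun m => rising c m / m.factorial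
  have hf (m : ℕ) : ((m : ℝ) + 1) * f (m + 1) = (c + m) * f m := by
    simp only [f, rising_succ, Nat.factorial_succ, Nat.cast_mul, Nat.cast_succ]
    have : (m.factorial : ℝ) ≠ 0 := by positivity
    field_simp
  change ∑ q ∈ Finset.HasAntidiagonal.antidiagonal n, f q.1 * f q.2 = _
  induction n with
  | zero => simp [f, rising]
  | succ n ih =>
    have hn : ((n : ℝ) + 1) ≠ 0 := by positivity
    have hfac : (n.factorial : ℝ) ≠ 0 := by positivity
    have h1 : ∑ q ∈ Finset.HasAntidiagonal.antidiagonal (n + 1), (q.1 : ℝ) * (f q.1 * f q.2) =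
        ∑ q ∈ Finset.HasAntidiagonal.antidiagonal n, (c + q.1) * (f q.1 * f q.2) := by
      rw [Finset.Nat.sum_antidiagonal_succ]
      simp only [Nat.cast_zero, zero_mul, zero_add, Nat.cast_succ]
      refine Finset.sum_congr rfl fun q _ => ?_
      linear_combination f q.2 * hf q.1
    have h2 : ∑ q ∈ Finset.HasAntidiagonal.antidiagonal (n + 1), (q.2 : ℝ) * (f q.1 * f q.2) =
        ∑ q ∈ Finset.HasAntidiagonal.antidiagonal n, (c + q.2) * (f q.1 * f q.2) := by
      rw [Finset.Nat.sum_antidiagonal_succ']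
      simp only [Nat.cast_zero, zero_mul, zero_add, Nat.cast_succ]
      refine Finset.sum_congr rfl fun q _ => ?_
      linear_combination f q.1 * hf q.2
    -- Weighting by `q.1 + q.2 = n + 1` and lowering one index with `hf` gives a first-order
    -- recurrence in `n`, the one satisfied by the right-hand side.
    have h3 : ((n : ℝ) + 1) * ∑ q ∈ Finset.HasAntidiagonal.antidiagonal (n + 1), f q.1 * f q.2 =
        (2 * c + n) * ∑ q ∈ Finset.HasAntidiagonal.antidiagonal n, f q.1 * f q.2 := by
      trans ∑ q ∈ Finset.HasAntidiagonal.antidiagonal (n + 1),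
        ((q.1 : ℝ) * (f q.1 * f q.2) + (q.2 : ℝ) * (f q.1 * f q.2))
      · rw [Finset.mul_sum]
        refine Finset.sum_congr rfl fun q hq => ?_
        have : (q.1 : ℝ) + q.2 = n + 1 := by exact_mod_cast Finset.HasAntidiagonal.mem_antidiagonal.1 hq
        rw [← this]
        ring
      · rw [Finset.sum_add_distrib, h1, h2, ← Finset.sum_add_distrib, Finset.mul_sum]
        refine Finset.sum_congr rfl fun q hq => ?_
        have : (q.1 : ℝ) + q.2 = n := by exact_mod_cast Finset.HasAntidiagonal.mem_antidiagonal.1 hq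
        rw [← this]
        ring
    rw [ih] at h3
    rw [rising_succ, Nat.factorial_succ]
    push_cast
    field_simp at h3 ⊢
    linear_combination h3

/-- The recurrence raises only `a`; for `a = 0` the reflection `selberg_comm` lets it raise `b`. -/
lemma selberg_mul_rising {p : ℝ} (hp : 1 < p) (a b : ℕ) :
    selberg p a b * (rising (2 + p / 2) (a + b) * rising (2 + p) (a + b)) =
      selberg p 0 0 * (a.factorial * b.factorial * rising (1 + p / 2) a * rising (1 + p / 2) b) := by
  have step (a b : ℕ) (h : selberg p a b * (rising (2 + p / 2) (a + b) * rising (2 + p) (a + b)) =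
      selberg p 0 0 *
        (a.factorial * b.factorial * rising (1 + p / 2) a * rising (1 + p / 2) b)) :
      selberg p (a + 1) b * (rising (2 + p / 2) (a + 1 + b) * rising (2 + p) (a + 1 + b)) =
      selberg p 0 0 *
        ((a + 1).factorial * b.factorial * rising (1 + p / 2) (a + 1) * rising (1 + p / 2) b) := by
    rw [add_right_comm a 1 b, rising_succ, rising_succ, rising_succ, Nat.factorial_succ]
    push_cast
    linear_combination (rising (2 + p / 2) (a + b) * rising (2 + p) (a + b)) *
      selberg_recurrence hp a b + (a + 1 + p / 2) * (a + 1) * h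
  induction a with
  | zero =>
    induction b with
    | zero => simp [rising]
    | succ b ih =>
      rw [selberg_comm] at ih ⊢
      have := step b 0 (by simpa [mul_comm, mul_left_comm, mul_assoc] using ih)
      simpa [mul_comm, mul_left_comm, mul_assoc] using this
  | succ a ih => exact step a b ih

/-- The squared binomials turn the closed form into a Chu-Vandermonde convolution with `c = 1 + p /
2`, and its value `rising (2 + p) n` cancels against the denominator. -/
lemma sum_choose_selberg {p : ℝ} (hp : 1 < p) (n : ℕ) :
    ∑ m ∈ Finset.range (n + 1), (n.choose m : ℝ) ^ 2 * selberg p m (n - m) =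
      n.factorial / ((p + 1) * rising (1 + p / 2) (n + 1)) := by
  have hr1 := rising_pos (c := 2 + p / 2) (by linarith) n
  have hr2 := rising_pos (c := 2 + p) (by linarith) n
  have hn : (n.factorial : ℝ) ≠ 0 := by positivity
  have term (q : ℕ × ℕ) (hq : q ∈ Finset.HasAntidiagonal.antidiagonal n) :
      (n.choose q.1 : ℝ) ^ 2 * selberg p q.1 q.2 =
      selberg p 0 0 * n.factorial ^ 2 / (rising (2 + p / 2) n * rising (2 + p) n) *
      (rising (1 + p / 2) q.1 / q.1.factorial * (rising (1 + p / 2) q.2 / q.2.factorial)) := by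
    obtain ⟨a, b⟩ := q
    obtain rfl : a + b = n := Finset.HasAntidiagonal.mem_antidiagonal.1 hq
    have h := selberg_mul_rising hp a b
    have ha : (a.factorial : ℝ) ≠ 0 := by positivity
    have hb : (b.factorial : ℝ) ≠ 0 := by positivity
    have hch : ((a + b).choose a : ℝ) * (a.factorial * b.factorial) = (a + b).factorial := by
      rw [← mul_assoc]
      have := Nat.choose_mul_factorial_mul_factorial (Nat.le_add_right a b)
      rw [Nat.add_sub_cancel_left] at this
      exact_mod_cast this
    simp only
    rw [← hch]
    generalize rising (2 + p / 2) (a + b) = R₁ at *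
    generalize rising (2 + p) (a + b) = R₂ at *
    generalize rising (1 + p / 2) a = A at *
    generalize rising (1 + p / 2) b = B at *
    generalize ((a + b).choose a : ℝ) = C at *
    field_simp
    linear_combination C ^ 2 * h
  rw [← Finset.Nat.sum_antidiagonal_eq_sum_range_succ
    (fun a b => (n.choose a : ℝ) ^ 2 * selberg p a b), Finset.sum_congr rfl term,
    ← Finset.mul_sum, sum_antidiagonal_rising, selberg_zero_zero hp, rising_succ',
    show 2 * (1 + p / 2) = 2 + p by ring, show 1 + p / 2 + 1 = 2 + p / 2 by ring]
  have h1 : p + 1 ≠ 0 := by linarith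
  have h2 : p + 2 ≠ 0 := by linarith
  have h3 : 2 + p ≠ 0 := by linarith
  have h4 : 1 + p / 2 ≠ 0 := by linarith
  field_simp
  ring

/-! ### The law of the points -/

/-- The uniform distribution on `[0,1]`. -/
abbrev unif : Measure ℝ := (volume : Measure ℝ).restrict (Set.Icc 0 1)

instance : IsProbabilityMeasure unif := ⟨by simp⟩

/-- The law of the points of one colour. -/
abbrev colourLaw (n : ℕ) : Measure (Fin n → ℝ) := Measure.pi fun _ => unif

instance (N : ℕ) : IsProbabilityMeasure (law N) :=
  inferInstanceAs (IsProbabilityMeasure (Measure.pi fun _ : Vertex N => unif))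

lemma law_eq_restrict (N : ℕ) :
    law N = (volume : Measure (Vertex N → ℝ)).restrict (Set.univ.pi fun _ => Set.Icc 0 1) := by
  rw [law, volume_pi, Measure.restrict_pi_pi]

lemma ae_mem_Icc (N : ℕ) : ∀ᵐ x ∂law N, ∀ v, x v ∈ Set.Icc (0 : ℝ) 1 := by
  rw [law_eq_restrict]
  filter_upwards [ae_restrict_mem (MeasurableSet.univ_pi fun _ => measurableSet_Icc)] with x hx v
  exact hx v trivial

/-- Two coordinates agree only on a proper linear subspace, which is a null set. -/
lemma ae_injective (N : ℕ) : ∀ᵐ x ∂law N, Function.Injective x := by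
  have key (u v : Vertex N) (huv : u ≠ v) : ∀ᵐ x ∂law N, x u ≠ x v := by
    have hac : law N ≪ (volume : Measure (Vertex N → ℝ)) := by
      rw [law_eq_restrict]
      exact Measure.restrict_le_self.absolutelyContinuous
    let L : (Vertex N → ℝ) →ₗ[ℝ] ℝ := 
      LinearMap.proj (R := ℝ) (φ := fun _ : Vertex N => ℝ) u -
        LinearMap.proj (R := ℝ) (φ := fun _ : Vertex N => ℝ) v
    have hL : LinearMap.ker L ≠ ⊤ := by
      intro h
      have h1 : (Pi.single u 1 : Vertex N → ℝ) ∈ LinearMap.ker L := h ▸ Submodule.mem_top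
      simp [L, huv.symm] at h1
    have h0 := Measure.addHaar_submodule (volume : Measure (Vertex N → ℝ)) _ hL
    rw [ae_iff]
    refine hac (measure_mono_null (fun x hx => ?_) h0)
    simpa [L, sub_eq_zero] using hx
  have h : ∀ᵐ x ∂law N, ∀ u v : Vertex N, u ≠ v → x u ≠ x v := by
    rw [ae_all_iff]
    intro u
    rw [ae_all_iff]
    intro v
    by_cases huv : u = v
    · simp [huv]
    · simpa [huv] using key u v huv
  filter_upwards [h] with x hx u v huv
  by_contra hne
  exact hx u v hne huv

/-- The number of the coordinates in a set has a binomial distribution. -/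
lemma pi_card_filter_mem (μ : Measure ℝ) [IsProbabilityMeasure μ] {A : Set ℝ}
    [DecidablePred (· ∈ A)] (hA : MeasurableSet A) (n m : ℕ) :
    (Measure.pi fun _ : Fin n => μ) {b | (Finset.univ.filter fun l => b l ∈ A).card = m} =
      n.choose m * μ A ^ m * μ Aᶜ ^ (n - m) := by
  classical
  have hset : {b : Fin n → ℝ | (Finset.univ.filter fun l => b l ∈ A).card = m} =
      ⋃ S ∈ Finset.powersetCard m (Finset.univ : Finset (Fin n)),
        Set.univ.pi fun l => if l ∈ S then A else Aᶜ := by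
    ext b
    simp only [Set.mem_ofPred_eq, Set.mem_iUnion, Finset.mem_powersetCard, Finset.subset_univ,
      true_and, exists_prop]
    constructor
    · intro h
      refine ⟨_, h, fun l _ => ?_⟩
      by_cases hl : b l ∈ A <;> simp [hl]
    · rintro ⟨S, hS, hb⟩
      rw [← hS]
      congr 1
      ext l
      have := hb l trivial
      by_cases hl : l ∈ S <;> simp_all
  rw [hset, measure_biUnion_finset]
  · rw [Finset.sum_congr rfl (g := fun _ => μ A ^ m * μ Aᶜ ^ (n - m))]
    · simp [mul_assoc]
    · intro S hS
      have hS' := (Finset.mem_powersetCard.1 hS).2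
      rw [Measure.pi_pi]
      simp only [apply_ite μ]
      rw [Finset.prod_ite]
      simp only [Finset.prod_const]
      congr 2
      · simp [hS']
      · rw [Finset.filter_not, ← Finset.compl_eq_univ_sdiff, Finset.card_compl]
        simp [hS']
  · intro S _ T _ hST
    refine Set.disjoint_left.2 fun b hb hb' => hST ?_
    ext l
    have h1 := hb l trivial
    have h2 := hb' l trivial
    by_cases hl : l ∈ S <;> by_cases hl' : l ∈ T <;> simp_all
  · intro S _
    refine MeasurableSet.univ_pi fun l => ?_
    split_ifs
    exacts [hA, hA.compl]

/-- A point is not to its own left, so its rank counts only the `n` other points, which are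
independent of its position. -/
lemma rank_eq_card_removeNth {n : ℕ} (b : Fin (n + 1) → ℝ) (i : Fin (n + 1)) :
    rank b i = (Finset.univ.filter fun l => b (i.succAbove l) ∈ Set.Iio (b i)).card := by
  simp only [rank, Finset.card_filter, Fin.sum_univ_succAbove _ i, lt_self_iff_false, if_false,
    zero_add, Set.mem_Iio]

lemma measurable_card_filter_lt {ι α : Type*} [Fintype ι] [MeasurableSpace α] {f : ι → α → ℝ}
    {g : α → ℝ} (hf : ∀ l, Measurable (f l)) (hg : Measurable g) :
    Measurable fun a => (Finset.univ.filter fun l => f l a < g a).card := by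
  simp only [Finset.card_filter]
  exact Finset.measurable_fun_sum _ fun l _ =>
    Measurable.ite (measurableSet_lt (hf l) hg) measurable_const measurable_const

lemma measurable_rank {ι : Type*} [Fintype ι] (i : ι) :
    Measurable fun b : ι → ℝ => rank b i :=
  measurable_card_filter_lt (fun l => measurable_pi_apply l) (measurable_pi_apply i)

/-- The probability that exactly `m` of `n` uniform points lie to the left of `s`. -/
def rankDensity (n m : ℕ) (s : ℝ) : ENNReal :=
  n.choose m * unif (Set.Iio s) ^ m * unif (Set.Iio s)ᶜ ^ (n - m)

lemma lintegral_colourLaw_succ {n : ℕ} (i : Fin (n + 1)) {G : ℝ × (Fin n → ℝ) → ENNReal}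
    (hG : Measurable G) :
    ∫⁻ b, G (b i, fun l => b (i.succAbove l)) ∂colourLaw (n + 1) =
      ∫⁻ s, ∫⁻ b, G (s, b) ∂colourLaw n ∂unif := by
  rw [← lintegral_prod _ hG.aemeasurable]
  exact (measurePreserving_piFinSuccAbove (fun _ : Fin (n + 1) => unif) i).lintegral_comp hG

/-- The joint law of the rank and the position of a point. -/
lemma lintegral_rank_eq {n : ℕ} (i : Fin (n + 1)) (m : ℕ) {F : ℝ → ENNReal} (hF : Measurable F) :
    ∫⁻ b, (if rank b i = m then F (b i) else 0) ∂colourLaw (n + 1) =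
      ∫⁻ s, rankDensity n m s * F s ∂unif := by
  have hcard : Measurable fun q : ℝ × (Fin n → ℝ) =>
      (Finset.univ.filter fun l => q.2 l ∈ Set.Iio q.1).card :=
    measurable_card_filter_lt (fun l => (measurable_pi_apply l).comp measurable_snd) measurable_fst
  have hG : Measurable fun q : ℝ × (Fin n → ℝ) =>
      if (Finset.univ.filter fun l => q.2 l ∈ Set.Iio q.1).card = m then F q.1 else 0 :=
    Measurable.ite (hcard (measurableSet_singleton m)) (hF.comp measurable_fst) measurable_const
  simp only [rank_eq_card_removeNth]
  rw [lintegral_colourLaw_succ i hG]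
  refine lintegral_congr fun s => ?_
  have hset : MeasurableSet
      {b : Fin n → ℝ | (Finset.univ.filter fun l => b l ∈ Set.Iio s).card = m} :=
    (hcard.comp measurable_prodMk_left) (measurableSet_singleton m)
  rw [rankDensity, ← pi_card_filter_mem unif measurableSet_Iio, mul_comm,
    ← lintegral_indicator_const hset]
  refine lintegral_congr fun b => ?_
  simp only [Set.indicator_apply, Set.mem_ofPred_eq]

lemma lintegral_law {N : ℕ} {G : (Fin N → ℝ) × (Fin N → ℝ) → ENNReal} (hG : Measurable G) :
    ∫⁻ x, G (fun i => x (Sum.inl i), fun j => x (Sum.inr j)) ∂law N =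
      ∫⁻ r, ∫⁻ b, G (r, b) ∂colourLaw N ∂colourLaw N := by
  rw [← lintegral_prod _ hG.aemeasurable]
  exact (measurePreserving_sumPiEquivProdPi (fun _ : Vertex N => unif)).lintegral_comp hG

lemma measurable_rankDensity (n m : ℕ) : Measurable (rankDensity n m) := by
  have h1 : Measurable fun s => unif (Set.Iio s) :=
    (show Monotone fun s => unif (Set.Iio s) from
      fun s t h => measure_mono (Set.Iio_subset_Iio h)).measurable
  have h2 : Measurable fun s => unif (Set.Iio s)ᶜ :=
    (show Antitone fun s => unif (Set.Iio s)ᶜ from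
      fun s t h => measure_mono (Set.compl_subset_compl.2 (Set.Iio_subset_Iio h))).measurable
  exact (measurable_const.mul (h1.pow_const m)).mul (h2.pow_const (n - m))

/-- The event is split by the common rank `m`; for fixed `m` the colours are independent, and each
contributes its `rankDensity`. -/
lemma lintegral_rank_eq_rank {n : ℕ} (i j : Fin (n + 1)) {F : ℝ × ℝ → ENNReal}
    (hF : Measurable F) :
    ∫⁻ x, (if rank (fun i => x (Sum.inl i)) i = rank (fun j => x (Sum.inr j)) j then
        F (x (Sum.inl i), x (Sum.inr j)) else 0) ∂law (n + 1) =
      ∑ m ∈ Finset.range (n + 1),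
        ∫⁻ s, ∫⁻ t, rankDensity n m s * (rankDensity n m t * F (s, t)) ∂unif ∂unif := by
  have hG (m : ℕ) : Measurable fun q : (Fin (n + 1) → ℝ) × (Fin (n + 1) → ℝ) =>
      if rank q.1 i = m then (if rank q.2 j = m then F (q.1 i, q.2 j) else 0) else 0 := by
    refine Measurable.ite (((measurable_rank i).comp measurable_fst) (measurableSet_singleton m))
      (Measurable.ite (((measurable_rank j).comp measurable_snd) (measurableSet_singleton m))
      (hF.comp (by fun_prop)) measurable_const) measurable_const
  have hsum (x : Vertex (n + 1) → ℝ) :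
      (if rank (fun i => x (Sum.inl i)) i = rank (fun j => x (Sum.inr j)) j then
        F (x (Sum.inl i), x (Sum.inr j)) else 0) =
      ∑ m ∈ Finset.range (n + 1), if rank (fun i => x (Sum.inl i)) i = m then
        (if rank (fun j => x (Sum.inr j)) j = m then F (x (Sum.inl i), x (Sum.inr j)) else 0)
        else 0 := by
    rw [Finset.sum_ite_eq, if_pos (c := _ ∈ Finset.range (n + 1))]
    · simp only [eq_comm]
    · rw [Finset.mem_range, rank_eq_card_removeNth, Nat.lt_succ_iff]
      exact (Finset.card_le_univ _).trans_eq (Fintype.card_fin n)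
  simp only [hsum]
  rw [lintegral_finsetSum]
  · refine Finset.sum_congr rfl fun m _ => ?_
    rw [lintegral_law (hG m)]
    have hin (r : Fin (n + 1) → ℝ) : ∫⁻ b, (if rank r i = m then
        (if rank b j = m then F (r i, b j) else 0) else 0) ∂colourLaw (n + 1) =
        if rank r i = m then ∫⁻ t, rankDensity n m t * F (r i, t) ∂unif else 0 := by
      split_ifs
      · exact lintegral_rank_eq j m (F := fun t => F (r i, t)) (hF.comp measurable_prodMk_left)
      · simp
    have hm : Measurable fun q : ℝ × ℝ => rankDensity n m q.2 * F (q.1, q.2) :=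
      ((measurable_rankDensity n m).comp measurable_snd).mul hF
    simp only [hin]
    rw [lintegral_rank_eq i m (F := fun s => ∫⁻ t, rankDensity n m t * F (s, t) ∂unif)
      hm.lintegral_prod_right']
    refine lintegral_congr fun s => ?_
    exact (lintegral_const_mul _ (hm.comp (measurable_prodMk_left (x := s)))).symm
  · intro m _
    exact (hG m).comp (g := fun q => _) (f := fun x : Vertex (n + 1) → ℝ =>
      ((fun i => x (Sum.inl i)), (fun j => x (Sum.inr j)))) (by fun_prop)

lemma rankDensity_eq {n m : ℕ} {s : ℝ} (hs : s ∈ Set.Icc (0 : ℝ) 1) :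
    rankDensity n m s = ENNReal.ofReal (n.choose m * (s ^ m * (1 - s) ^ (n - m))) := by
  obtain ⟨h0, h1⟩ := hs
  have h2 : unif (Set.Iio s) = ENNReal.ofReal s := by
    rw [Measure.restrict_apply measurableSet_Iio,
      show Set.Iio s ∩ Set.Icc 0 1 = Set.Ico 0 s by ext; simp; grind]
    simp
  have h3 : unif (Set.Iio s)ᶜ = ENNReal.ofReal (1 - s) := by
    rw [prob_compl_eq_one_sub measurableSet_Iio, h2, ENNReal.ofReal_sub _ h0, ENNReal.ofReal_one]
  have h4 : 0 ≤ 1 - s := by linarith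
  rw [rankDensity, h2, h3, ENNReal.ofReal_mul (by positivity), ENNReal.ofReal_natCast,
    ENNReal.ofReal_mul (by positivity), ENNReal.ofReal_pow h0, ENNReal.ofReal_pow h4, mul_assoc]

/-! ### The average cost of the matching -/

lemma lintegral_unif_ofReal {f : ℝ → ℝ} (hf : Continuous f) (h0 : ∀ x ∈ Set.Icc (0 : ℝ) 1, 0 ≤ f x) :
    ∫⁻ x, ENNReal.ofReal (f x) ∂unif = ENNReal.ofReal (∫ x in (0 : ℝ)..1, f x) := by
  rw [intervalIntegral.integral_of_le zero_le_one, ← integral_Icc_eq_integral_Ioc,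
    ofReal_integral_eq_lintegral_ofReal]
  · exact hf.continuousOn.integrableOn_compact isCompact_Icc
  · filter_upwards [ae_restrict_mem measurableSet_Icc] with x hx using h0 x hx

lemma lintegral_rankDensity {p : ℝ} (hp : 1 < p) (n m : ℕ) :
    ∫⁻ s, ∫⁻ t, rankDensity n m s * (rankDensity n m t * ENNReal.ofReal (|s - t| ^ p))
      ∂unif ∂unif = ENNReal.ofReal ((n.choose m : ℝ) ^ 2 * selberg p m (n - m)) := by
  have hc := continuous_selbergFun hp m (n - m)
  have hmem : ∀ᵐ s ∂unif, s ∈ Set.Icc (0 : ℝ) 1 := ae_restrict_mem measurableSet_Icc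
  have hpos : ∀ s ∈ Set.Icc (0 : ℝ) 1, ∀ t ∈ Set.Icc (0 : ℝ) 1,
      0 ≤ (n.choose m : ℝ) ^ 2 * selbergFun p m (n - m) t s := by
    rintro s ⟨hs0, hs1⟩ t ⟨ht0, ht1⟩
    have : 0 ≤ 1 - s := by linarith
    have : 0 ≤ 1 - t := by linarith
    unfold selbergFun
    positivity
  rw [selberg, ← sq_const_mul, sq, ← lintegral_unif_ofReal]
  · refine lintegral_congr_ae (hmem.mono fun s hs => ?_)
    simp only
    rw [← lintegral_unif_ofReal _ (hpos s hs)]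
    · refine lintegral_congr_ae (hmem.mono fun t ht => ?_)
      have hs' : 0 ≤ 1 - s := by linarith [hs.2]
      have ht' : 0 ≤ 1 - t := by linarith [ht.2]
      have hs0 := hs.1
      have ht0 := ht.1
      simp only
      rw [rankDensity_eq hs, rankDensity_eq ht, ← ENNReal.ofReal_mul (by positivity),
        ← ENNReal.ofReal_mul (by positivity), selbergFun, abs_sub_comm t s]
      congr 1
      ring
    · exact continuous_const.mul (hc.comp (continuous_id.prodMk continuous_const))
  · exact continuous_inner (f := fun x y => (n.choose m : ℝ) ^ 2 * selbergFun p m (n - m) x y)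
      (continuous_const.mul hc)
  · intro s hs
    refine intervalIntegral.integral_nonneg zero_le_one fun t ht => hpos s hs t ht

/-- The average cost of the optimal matching. -/
def exactMatching (p : ℝ) (N : ℕ) : ℝ := N * N.factorial / ((p + 1) * rising (1 + p / 2) N)

lemma exactMatching_nonneg {p : ℝ} (hp : 1 < p) (N : ℕ) : 0 ≤ exactMatching p N := by
  have := (rising_pos (c := 1 + p / 2) (by linarith) N).le
  unfold exactMatching
  positivity

lemma lintegral_matchingCost {p : ℝ} (hp : 1 < p) (n : ℕ) :
    ∫⁻ x, ENNReal.ofReal (matchingCost (K (n + 1)) (weight p x)) ∂law (n + 1) =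
      ENNReal.ofReal (exactMatching p (n + 1)) := by
  have hF : Measurable fun q : ℝ × ℝ => ENNReal.ofReal (|q.1 - q.2| ^ p) := by fun_prop
  have hrank (i : Fin (n + 1)) : Measurable fun x : Vertex (n + 1) → ℝ =>
      rank (fun i => x (Sum.inl i)) i := (measurable_rank i).comp (by fun_prop)
  have hrank' (j : Fin (n + 1)) : Measurable fun x : Vertex (n + 1) → ℝ =>
      rank (fun j => x (Sum.inr j)) j := (measurable_rank j).comp (by fun_prop)
  have hmeas (i j : Fin (n + 1)) : Measurable fun x : Vertex (n + 1) → ℝ =>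
      if rank (fun i => x (Sum.inl i)) i = rank (fun j => x (Sum.inr j)) j then
        ENNReal.ofReal (|x (Sum.inl i) - x (Sum.inr j)| ^ p) else 0 :=
    Measurable.ite (measurableSet_eq_fun (hrank i) (hrank' j)) (by fun_prop) measurable_const
  trans ∫⁻ x, ∑ i, ∑ j, (if rank (fun i => x (Sum.inl i)) i = rank (fun j => x (Sum.inr j)) j then
      ENNReal.ofReal (|x (Sum.inl i) - x (Sum.inr j)| ^ p) else 0) ∂law (n + 1)
  · refine lintegral_congr_ae ((ae_injective (n + 1)).mono fun x hx => ?_)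
    simp only
    have hr : Function.Injective fun i => x (Sum.inl i) := hx.comp Sum.inl_injective
    have hb : Function.Injective fun j => x (Sum.inr j) := hx.comp Sum.inr_injective
    rw [matchingCost_weight hp.le, sortedCost_eq_sum_rank p hr hb, ENNReal.ofReal_sum_of_nonneg fun i _ =>
        Finset.sum_nonneg fun j _ => by positivity]
    refine Finset.sum_congr rfl fun i _ => ?_
    rw [ENNReal.ofReal_sum_of_nonneg fun j _ => by positivity]
    refine Finset.sum_congr rfl fun j _ => ?_
    split_ifs <;> simp
  · have hS (m : ℕ) : 0 ≤ (n.choose m : ℝ) ^ 2 * selberg p m (n - m) := by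
      refine mul_nonneg (by positivity) ?_
      refine intervalIntegral.integral_nonneg zero_le_one fun y hy =>
        intervalIntegral.integral_nonneg zero_le_one fun x hx => ?_
      have h1 : 0 ≤ 1 - x := by linarith [hx.2]
      have h2 : 0 ≤ 1 - y := by linarith [hy.2]
      have h3 := hx.1
      have h4 := hy.1
      unfold selbergFun
      positivity
    -- The value does not depend on `i` and `j`, so the total is `(n + 1) ^ 2` times it.
    have hij (i j : Fin (n + 1)) : ∫⁻ x, (if rank (fun i => x (Sum.inl i)) i =
          rank (fun j => x (Sum.inr j)) j then
        ENNReal.ofReal (|x (Sum.inl i) - x (Sum.inr j)| ^ p) else 0) ∂law (n + 1) =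
        ENNReal.ofReal (n.factorial / ((p + 1) * rising (1 + p / 2) (n + 1))) := by
      rw [lintegral_rank_eq_rank i j hF]
      simp only [lintegral_rankDensity hp]
      rw [← ENNReal.ofReal_sum_of_nonneg fun m _ => hS m, sum_choose_selberg hp]
    rw [lintegral_finsetSum _ fun i _ => Finset.measurable_fun_sum _ fun j _ => hmeas i j]
    simp only [lintegral_finsetSum _ fun j _ => hmeas _ j, hij]
    have := (rising_pos (c := 1 + p / 2) (by linarith) (n + 1)).le
    simp only [Finset.sum_const, Finset.card_univ, Fintype.card_fin, nsmul_eq_mul]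
    rw [← ENNReal.ofReal_natCast, ← ENNReal.ofReal_mul (by positivity),
      ← ENNReal.ofReal_mul (by positivity), exactMatching, Nat.factorial_succ]
    congr 1
    push_cast
    ring

/-! ### The average of the gaps -/

lemma measurable_gap {ι : Type*} [Finite ι] (p : ℝ) (i j : ι) :
    Measurable fun b : ι → ℝ => gap p b i j := by
  unfold gap
  refine Measurable.ite ?_ (by fun_prop) measurable_const
  rw [show {b : ι → ℝ | b i < b j ∧ ∀ l, ¬ (b i < b l ∧ b l < b j)} =
    {b | b i < b j} ∩ ⋂ l, ({b | b i < b l} ∩ {b | b l < b j})ᶜ by ext; simp]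
  refine (measurableSet_lt (measurable_pi_apply i) (measurable_pi_apply j)).inter ?_
  refine MeasurableSet.iInter fun l => ?_
  exact ((measurableSet_lt (measurable_pi_apply i) (measurable_pi_apply l)).inter
    (measurableSet_lt (measurable_pi_apply l) (measurable_pi_apply j))).compl

lemma lintegral_exp_bound {p : ℝ} (hp : 1 < p) {n : ℕ} (hn : 0 < n) (s : ℝ) :
    ∫⁻ t, (if s < t then ENNReal.ofReal (|s - t| ^ p * Real.exp (-(n * (t - s)))) else 0) ≤
      ENNReal.ofReal (Real.Gamma (p + 1) / n ^ (p + 1)) := by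
  have hn' : (0 : ℝ) < n := by exact_mod_cast hn
  have hint := Real.integral_rpow_mul_exp_neg_mul_Ioi (a := p + 1) (r := n) (by linarith) hn'
  -- A function that is not integrable would have integral 0 by convention, whereas the Gamma
  -- integral is positive.
  have hI : IntegrableOn (fun t : ℝ => t ^ (p + 1 - 1) * Real.exp (-(n * t))) (Set.Ioi 0) := by
    by_contra h
    rw [integral_undef h] at hint
    have : 0 < (1 / (n : ℝ)) ^ (p + 1) * Real.Gamma (p + 1) :=
      mul_pos (by positivity) (Real.Gamma_pos_of_pos (by linarith))
    linarith
  rw [← lintegral_add_right_eq_self _ s]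
  trans ∫⁻ t in Set.Ioi (0 : ℝ), ENNReal.ofReal (t ^ (p + 1 - 1) * Real.exp (-(n * t)))
  · rw [← lintegral_indicator measurableSet_Ioi]
    refine lintegral_mono fun t => ?_
    simp only [Set.indicator_apply, Set.mem_Ioi, lt_add_iff_pos_left]
    split_ifs with h
    · rw [add_sub_cancel_right, add_sub_cancel_right, abs_sub_comm, add_sub_cancel_right,
        abs_of_pos h]
    · rfl
  · rw [← ofReal_integral_eq_lintegral_ofReal hI, hint, Real.div_rpow zero_le_one hn'.le,
      Real.one_rpow, one_div_mul_eq_div]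
    filter_upwards [ae_restrict_mem measurableSet_Ioi] with t ht
    have : (0 : ℝ) < t := ht
    positivity

lemma unif_compl_Ioo {s t : ℝ} (hs : 0 ≤ s) (ht : t ≤ 1) (hst : s < t) :
    unif (Set.Ioo s t)ᶜ = ENNReal.ofReal (1 - (t - s)) := by
  rw [prob_compl_eq_one_sub measurableSet_Ioo, Measure.restrict_apply measurableSet_Ioo,
    show Set.Ioo s t ∩ Set.Icc 0 1 = Set.Ioo s t by ext; simp; grind, Real.volume_Ioo,
    ← ENNReal.ofReal_one, ← ENNReal.ofReal_sub _ (by linarith)]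

/-- Given the ends `s < t`, the other `n` points must avoid the interval between them, which has
probability `(1 - (t - s)) ^ n ≤ exp (-n * (t - s))`. Integrating over `t` leaves a Gamma integral.
-/
lemma lintegral_gap_le {p : ℝ} (hp : 1 < p) {n : ℕ} (hn : 0 < n) (i j : Fin (n + 2)) :
    ∫⁻ b, ENNReal.ofReal (gap p b i j) ∂colourLaw (n + 2) ≤
      ENNReal.ofReal (Real.Gamma (p + 1) / n ^ (p + 1)) := by
  obtain rfl | hij := eq_or_ne i j
  · simp [gap]
  obtain ⟨k, rfl⟩ := Fin.exists_succAbove_eq hij.symm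
  -- the gap from `s` to `t`, in the absence of the points `b`
  let G : ℝ → ℝ × (Fin n → ℝ) → ENNReal := fun s q =>
    if s < q.1 ∧ ∀ l, q.2 l ∈ (Set.Ioo s q.1)ᶜ then ENNReal.ofReal (|s - q.1| ^ p) else 0
  have hG : Measurable fun q : ℝ × ℝ × (Fin n → ℝ) => G q.1 q.2 := by
    refine Measurable.ite ?_ (by fun_prop) measurable_const
    rw [show {q : ℝ × ℝ × (Fin n → ℝ) | q.1 < q.2.1 ∧ ∀ l, q.2.2 l ∈ (Set.Ioo q.1 q.2.1)ᶜ} =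
      {q | q.1 < q.2.1} ∩ ⋂ l, ({q | q.1 < q.2.2 l} ∩ {q | q.2.2 l < q.2.1})ᶜ by ext; simp]
    refine (measurableSet_lt (by fun_prop) (by fun_prop)).inter ?_
    refine MeasurableSet.iInter fun l => ?_
    exact ((measurableSet_lt (by fun_prop) (by fun_prop)).inter
      (measurableSet_lt (by fun_prop) (by fun_prop))).compl
  have hGs (s : ℝ) : Measurable (G s) := hG.comp measurable_prodMk_left
  let H : ℝ × (Fin (n + 1) → ℝ) → ENNReal := fun q =>
    G q.1 (q.2 k, fun l => q.2 (k.succAbove l))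
  have hH : Measurable H := hG.comp (g := fun q : ℝ × ℝ × (Fin n → ℝ) => G q.1 q.2)
    (f := fun q : ℝ × (Fin (n + 1) → ℝ) => (q.1, q.2 k, fun l => q.2 (k.succAbove l)))
    (by fun_prop)
  calc ∫⁻ b, ENNReal.ofReal (gap p b i (i.succAbove k)) ∂colourLaw (n + 2)
      ≤ ∫⁻ b, H (b i, fun l => b (i.succAbove l)) ∂colourLaw (n + 2) := by
        refine lintegral_mono fun b => ?_
        simp only [gap, H, G]
        split_ifs with h1 h2
        · exact le_rfl
        · exact absurd ⟨h1.1, fun l hl => h1.2 _ hl⟩ h2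
        · simp
        · simp
    _ = ∫⁻ s, ∫⁻ b, H (s, b) ∂colourLaw (n + 1) ∂unif := lintegral_colourLaw_succ i hH
    _ = ∫⁻ s, ∫⁻ t, ∫⁻ b, G s (t, b) ∂colourLaw n ∂unif ∂unif :=
        lintegral_congr fun s => lintegral_colourLaw_succ k (hGs s)
    _ ≤ ∫⁻ _, ENNReal.ofReal (Real.Gamma (p + 1) / n ^ (p + 1)) ∂unif := by
        refine lintegral_mono_ae ?_
        filter_upwards [ae_restrict_mem measurableSet_Icc] with s hs
        refine le_trans ?_ (lintegral_exp_bound hp hn s)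
        -- The bound on `t` from the unit interval is dropped; the exponential makes the tail
        -- harmless.
        refine le_trans ?_ (setLIntegral_le_lintegral (Set.Icc 0 1) _)
        refine lintegral_mono_ae ?_
        filter_upwards [ae_restrict_mem measurableSet_Icc] with t ht
        by_cases hst : s < t
        · have h1 : 0 ≤ 1 - (t - s) := by linarith [hs.1, ht.2]
          have hset : MeasurableSet (Set.univ.pi fun _ : Fin n => (Set.Ioo s t)ᶜ) :=
            MeasurableSet.univ_pi fun _ => measurableSet_Ioo.compl
          have : ∀ b : Fin n → ℝ, G s (t, b) = (Set.univ.pi fun _ : Fin n => (Set.Ioo s t)ᶜ).indicator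
              (fun _ => ENNReal.ofReal (|s - t| ^ p)) b := by
            intro b
            by_cases hb : ∀ l, b l ∈ (Set.Ioo s t)ᶜ
            · rw [Set.indicator_of_mem (Set.mem_univ_pi.2 hb)]
              exact if_pos ⟨hst, hb⟩
            · rw [Set.indicator_of_notMem fun h => hb (Set.mem_univ_pi.1 h)]
              exact if_neg fun h => hb h.2
          simp only [this]
          rw [lintegral_indicator_const hset, Measure.pi_pi, Finset.prod_const, Finset.card_univ,
            Fintype.card_fin, unif_compl_Ioo hs.1 ht.2 hst, if_pos hst, ← ENNReal.ofReal_pow h1,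
            ← ENNReal.ofReal_mul (by positivity)]
          refine ENNReal.ofReal_le_ofReal ?_
          gcongr
          rw [show -((n : ℝ) * (t - s)) = n * (-(t - s)) by ring, Real.exp_nat_mul]
          gcongr
          linarith [Real.add_one_le_exp (-(t - s))]
        · simp [G, hst]
    _ = ENNReal.ofReal (Real.Gamma (p + 1) / n ^ (p + 1)) := by simp

lemma lintegral_gapSum_le {p : ℝ} (hp : 1 < p) {n : ℕ} (hn : 0 < n) :
    ∫⁻ x, ENNReal.ofReal (gapSum p fun j => x (Sum.inr j)) ∂law (n + 2) ≤
      ENNReal.ofReal ((n + 2) ^ 2 * (Real.Gamma (p + 1) / n ^ (p + 1))) := by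
  have hgap (b : Fin (n + 2) → ℝ) : ENNReal.ofReal (gapSum p b) =
      ∑ i, ∑ j, ENNReal.ofReal (gap p b i j) := by
    rw [gapSum, ENNReal.ofReal_sum_of_nonneg fun i _ =>
      Finset.sum_nonneg fun j _ => gap_nonneg p b i j]
    exact Finset.sum_congr rfl fun i _ =>
      ENNReal.ofReal_sum_of_nonneg fun j _ => gap_nonneg p b i j
  have hm (i j : Fin (n + 2)) : Measurable fun b : Fin (n + 2) → ℝ => ENNReal.ofReal (gap p b i j) :=
    (measurable_gap p i j).ennreal_ofReal
  simp only [hgap]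
  rw [lintegral_law (G := fun q => ∑ i, ∑ j, ENNReal.ofReal (gap p q.2 i j))
    (Finset.measurable_fun_sum _ fun i _ => Finset.measurable_fun_sum _ fun j _ =>
      (hm i j).comp measurable_snd)]
  simp only [lintegral_const, measure_univ, mul_one]
  rw [lintegral_finsetSum _ fun i _ => Finset.measurable_fun_sum _ fun j _ => hm i j]
  simp only [lintegral_finsetSum _ fun j _ => hm _ j]
  refine (Finset.sum_le_sum fun i _ => Finset.sum_le_sum fun j _ =>
    lintegral_gap_le hp hn i j).trans_eq ?_
  have := (Real.Gamma_pos_of_pos (s := p + 1) (by linarith)).le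
  simp only [Finset.sum_const, Finset.card_univ, Fintype.card_fin, nsmul_eq_mul]
  rw [← ENNReal.ofReal_natCast, ← ENNReal.ofReal_mul (by positivity),
    ← ENNReal.ofReal_mul (by positivity)]
  congr 1
  push_cast
  ring

/-! ### Integrability -/

lemma measurable_cost (p : ℝ) {V : Type*} [Fintype V] (H : SimpleGraph V) :
    Measurable fun x : V → ℝ => cost (weight p x) H := by
  unfold cost
  refine Finset.measurable_fun_sum _ fun e _ => ?_
  induction e using Sym2.ind with
  | _ u v =>
    simp only [weight_mk]
    fun_prop

lemma measurable_sInf_costs (p : ℝ) {V : Type*} [Fintype V] (P : SimpleGraph V → Prop) :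
    Measurable fun x : V → ℝ => sInf {c | ∃ H, P H ∧ cost (weight p x) H = c} :=
  Measurable.sInf (s := {H | P H}) (f := fun H (x : V → ℝ) => cost (weight p x) H)
    (Set.to_countable _) fun H _ => measurable_cost p H

lemma cost_mem_Icc {p : ℝ} (hp : 0 < p) {N : ℕ} {x : Vertex N → ℝ}
    (hx : ∀ v, x v ∈ Set.Icc (0 : ℝ) 1) (H : SimpleGraph (Vertex N)) :
    cost (weight p x) H ∈ Set.Icc (0 : ℝ) (Fintype.card (Sym2 (Vertex N))) := by
  classical
  have hw (e : Sym2 (Vertex N)) : weight p x e ∈ Set.Icc (0 : ℝ) 1 := by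
    induction e using Sym2.ind with
    | _ u v =>
      rw [weight_mk]
      refine ⟨by positivity, Real.rpow_le_one (abs_nonneg _) ?_ hp.le⟩
      rw [abs_le]
      constructor <;> linarith [(hx u).1, (hx u).2, (hx v).1, (hx v).2]
  refine ⟨Finset.sum_nonneg fun e _ => (hw e).1, ?_⟩
  refine (Finset.sum_le_card_nsmul _ _ 1 fun e _ => (hw e).2).trans ?_
  rw [nsmul_eq_mul, mul_one]
  exact_mod_cast Finset.card_le_univ _

/-- The minimum is attained, hence is the cost of some subgraph; for points in the unit interval
every weight is at most 1, so this cost is bounded by the number of pairs. -/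
lemma integrable_of_isLeast {p : ℝ} (hp : 0 < p) {N : ℕ} {P : SimpleGraph (Vertex N) → Prop}
    (h : ∀ w, IsLeast {c | ∃ H, P H ∧ cost w H = c} (sInf {c | ∃ H, P H ∧ cost w H = c})) :
    Integrable (fun x => sInf {c | ∃ H, P H ∧ cost (weight p x) H = c}) (law N) := by
  refine Integrable.of_bound (measurable_sInf_costs p P).aestronglyMeasurable
    (Fintype.card (Sym2 (Vertex N))) ?_
  filter_upwards [ae_mem_Icc N] with x hx
  obtain ⟨H, -, hH⟩ := (h (weight p x)).1
  rw [← hH, Real.norm_of_nonneg (cost_mem_Icc hp hx H).1]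
  exact (cost_mem_Icc hp hx H).2

variable {p : ℝ}

lemma integrable_matchingCost (hp : 0 < p) :
    Integrable (fun x => matchingCost (K N) (weight p x)) (law N) :=
  integrable_of_isLeast hp fun w => isLeast_matchingCost w

lemma integrable_twoMatchingCost (hp : 0 < p) (hN : 2 ≤ N) :
    Integrable (fun x => twoMatchingCost (K N) (weight p x)) (law N) :=
  integrable_of_isLeast hp fun w => isLeast_twoMatchingCost hN w

lemma integrable_tspCost (hp : 0 < p) (hN : 2 ≤ N) :
    Integrable (fun x => tspCost (K N) (weight p x)) (law N) :=
  integrable_of_isLeast hp fun w => isLeast_tspCost hN w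

/-! ### The average costs -/

lemma matchingCost_weight_nonneg (hp : 1 ≤ p) (x : Vertex N → ℝ) :
    0 ≤ matchingCost (K N) (weight p x) := by
  rw [matchingCost_weight hp]
  exact Finset.sum_nonneg fun k _ => by positivity

lemma avgMatching_eq (hp : 1 < p) (hN : 2 ≤ N) : avgMatching p N = exactMatching p N := by
  obtain ⟨n, rfl⟩ : ∃ n, N = n + 1 := ⟨N - 1, by omega⟩
  rw [avgMatching, integral_eq_lintegral_of_nonneg_ae
    (ae_of_all _ fun x => matchingCost_weight_nonneg hp.le x)
    (integrable_matchingCost (by linarith)).aestronglyMeasurable, lintegral_matchingCost hp,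
    ENNReal.toReal_ofReal (exactMatching_nonneg hp _)]

lemma two_mul_avgMatching_le (hp : 1 < p) (hN : 2 ≤ N) :
    2 * avgMatching p N ≤ avgTwoMatching p N := by
  rw [avgMatching, ← integral_const_mul]
  exact integral_mono ((integrable_matchingCost (by linarith)).const_mul 2)
    (integrable_twoMatchingCost (by linarith) hN) fun x => two_mul_matchingCost_le hN _

lemma avgTwoMatching_le (hp : 1 < p) (hN : 2 ≤ N) : avgTwoMatching p N ≤ avgTSP p N :=
  integral_mono (integrable_twoMatchingCost (by linarith) hN)
    (integrable_tspCost (by linarith) hN) fun x => twoMatchingCost_le_tspCost hN _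

lemma avgTSP_le (hp : 1 < p) {n : ℕ} (hn : 0 < n) {t : ℝ} (h0 : 0 < t) (h1 : t < 1) :
    avgTSP p (n + 2) ≤ (1 - t) ^ (1 - p) * (2 * exactMatching p (n + 2)) +
      t ^ (1 - p) * (2 * ((n + 2) ^ 2 * (Real.Gamma (p + 1) / n ^ (p + 1)))) := by
  have hp0 : 0 < p := by linarith
  have ht : 0 < 1 - t := by linarith
  have hN : 2 ≤ n + 2 := by omega
  have hE := exactMatching_nonneg hp (n + 2)
  have hΓ := (Real.Gamma_pos_of_pos (s := p + 1) (by linarith)).le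
  have hA : 0 ≤ (1 - t) ^ (1 - p) := by positivity
  have hB : 0 ≤ t ^ (1 - p) := by positivity
  have h2A : 0 ≤ (1 - t) ^ (1 - p) * 2 := by positivity
  have h2B : 0 ≤ t ^ (1 - p) * 2 := by positivity
  rw [avgTSP, integral_eq_lintegral_of_nonneg_ae (ae_of_all _ fun x =>
      (mul_nonneg two_pos.le (matchingCost_weight_nonneg hp.le x)).trans
        ((two_mul_matchingCost_le hN _).trans (twoMatchingCost_le_tspCost hN _)))
    (integrable_tspCost hp0 hN).aestronglyMeasurable]
  refine ENNReal.toReal_le_of_le_ofReal (by positivity) ?_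
  have hg0 (x : Vertex (n + 2) → ℝ) : 0 ≤ gapSum p fun j => x (Sum.inr j) :=
    Finset.sum_nonneg fun i _ => Finset.sum_nonneg fun j _ => gap_nonneg _ _ _ _
  calc ∫⁻ x, ENNReal.ofReal (tspCost (K (n + 2)) (weight p x)) ∂law (n + 2)
      ≤ ∫⁻ x, (ENNReal.ofReal ((1 - t) ^ (1 - p) * 2) *
          ENNReal.ofReal (matchingCost (K (n + 2)) (weight p x)) +
          ENNReal.ofReal (t ^ (1 - p) * 2) *
          ENNReal.ofReal (gapSum p fun j => x (Sum.inr j))) ∂law (n + 2) := by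
        refine lintegral_mono_ae ((ae_injective (n + 2)).mono fun x hx => ?_)
        have hm := matchingCost_weight_nonneg hp.le x
        rw [← ENNReal.ofReal_mul h2A, ← ENNReal.ofReal_mul h2B,
          ← ENNReal.ofReal_add (mul_nonneg h2A hm) (mul_nonneg h2B (hg0 x))]
        refine ENNReal.ofReal_le_ofReal ((tspCost_le hp h0 h1 hN hx).trans_eq ?_)
        ring
    _ = ENNReal.ofReal ((1 - t) ^ (1 - p) * 2) * ENNReal.ofReal (exactMatching p (n + 2)) +
          ENNReal.ofReal (t ^ (1 - p) * 2) *
          ∫⁻ x, ENNReal.ofReal (gapSum p fun j => x (Sum.inr j)) ∂law (n + 2) := by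
        rw [lintegral_add_left' ((integrable_matchingCost
            hp0).aestronglyMeasurable.aemeasurable.ennreal_ofReal.const_mul _),
          lintegral_const_mul' _ _ ENNReal.ofReal_ne_top,
          lintegral_const_mul' _ _ ENNReal.ofReal_ne_top, lintegral_matchingCost hp]
    _ ≤ ENNReal.ofReal ((1 - t) ^ (1 - p) * 2) * ENNReal.ofReal (exactMatching p (n + 2)) +
          ENNReal.ofReal (t ^ (1 - p) * 2) *
          ENNReal.ofReal ((n + 2) ^ 2 * (Real.Gamma (p + 1) / n ^ (p + 1))) := by
        gcongr
        exact lintegral_gapSum_le hp hn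
    _ = _ := by
        rw [← ENNReal.ofReal_mul h2A, ← ENNReal.ofReal_mul h2B,
          ← ENNReal.ofReal_add (by positivity) (by positivity)]
        congr 1
        ring

/-! ### Asymptotics -/

/-- The common limit of the scaled average costs. -/
def limitCost (p : ℝ) : ℝ := 2 * (p / 2 * Real.Gamma (p / 2) / (p + 1))

lemma limitCost_pos (hp : 1 < p) : 0 < limitCost p := by
  have := Real.Gamma_pos_of_pos (s := p / 2) (by linarith)
  unfold limitCost
  positivity

/-- The denominator of Euler's sequence for `Γ(p / 2)` runs from `p / 2` to `p / 2 + N`; splitting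
off its first factor leaves `rising (1 + p / 2) N`. -/
lemma exactMatching_div_eq (hp : 1 < p) (hN : 0 < N) :
    exactMatching p N / (N : ℝ) ^ (1 - p / 2) = p / 2 * Real.GammaSeq (p / 2) N / (p + 1) := by
  have hN' : (0 : ℝ) < N := by exact_mod_cast hN
  have hr := rising_pos (c := 1 + p / 2) (by linarith) N
  have h1 : Real.GammaSeq (p / 2) N =
      (N : ℝ) ^ (p / 2) * N.factorial / (p / 2 * rising (1 + p / 2) N) := by
    rw [Real.GammaSeq, add_comm 1, ← rising_succ', rising]
  have h2 : (N : ℝ) ^ (p / 2) ≠ 0 := by positivity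
  rw [h1, exactMatching, Real.rpow_sub hN', Real.rpow_one]
  generalize rising (1 + p / 2) N = R at *
  generalize (N : ℝ) ^ (p / 2) = Q at *
  field_simp

lemma tendsto_exactMatching (hp : 1 < p) :
    Tendsto (fun N : ℕ => 2 * exactMatching p N / (N : ℝ) ^ (1 - p / 2)) atTop
      (𝓝 (limitCost p)) := by
  refine (((Real.GammaSeq_tendsto_Gamma (p / 2)).const_mul (p / 2)).div_const
    (p + 1)).const_mul 2 |>.congr' ?_
  filter_upwards [eventually_gt_atTop 0] with N hN
  rw [← exactMatching_div_eq hp hN, mul_div_assoc]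

/-- With `M = n + 2` and `t = M ^ (-1/2)` the exponents `(p - 1) / 2`, `2`, `-(p + 1)` and `-(1 - p
/ 2)` add up to `-1/2` for every `p`. -/
lemma tendsto_gap_bound (hp : 1 < p) :
    Tendsto (fun n : ℕ => (((n + 2 : ℕ) : ℝ) ^ (-(1 / 2) : ℝ)) ^ (1 - p) *
      (2 * ((n + 2) ^ 2 * (Real.Gamma (p + 1) / n ^ (p + 1)))) /
        ((n + 2 : ℕ) : ℝ) ^ (1 - p / 2)) atTop (𝓝 0) := by
  have hlim : Tendsto (fun n : ℕ => ((n + 2 : ℕ) : ℝ) ^ (-(1 / 2) : ℝ)) atTop (𝓝 0) :=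
    (tendsto_rpow_neg_atTop (by norm_num : (0 : ℝ) < 1 / 2)).comp
      (tendsto_natCast_atTop_atTop.comp (tendsto_add_atTop_nat 2))
  have hlim' := hlim.const_mul (2 * Real.Gamma (p + 1) * 3 ^ (p + 1))
  rw [mul_zero] at hlim'
  have hΓ := (Real.Gamma_pos_of_pos (s := p + 1) (by linarith)).le
  refine squeeze_zero' (Eventually.of_forall fun n => by positivity) ?_ hlim'
  filter_upwards [eventually_gt_atTop 0] with n hn
  have hn' : (1 : ℝ) ≤ n := by exact_mod_cast hn
  have hM : (0 : ℝ) < ((n + 2 : ℕ) : ℝ) := by positivity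
  -- Replaces the power of `n` by one of `n + 2`; this is the source of the constant `3 ^ (p + 1)`.
  have hle : ((n + 2 : ℕ) : ℝ) ≤ 3 * n := by push_cast; linarith
  have h1 : ((n + 2 : ℕ) : ℝ) ^ (p + 1) ≤ 3 ^ (p + 1) * (n : ℝ) ^ (p + 1) := by
    rw [← Real.mul_rpow (by norm_num) (by linarith)]
    exact Real.rpow_le_rpow hM.le hle (by linarith)
  have h2 : ((n : ℝ) ^ (p + 1))⁻¹ ≤ 3 ^ (p + 1) * (((n + 2 : ℕ) : ℝ) ^ (p + 1))⁻¹ := by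
    rw [← div_eq_mul_inv, le_div_iff₀ (by positivity), inv_mul_le_iff₀ (by positivity), mul_comm]
    exact h1
  have h3 : (((n + 2 : ℕ) : ℝ) ^ (-(1 / 2) : ℝ)) ^ (1 - p) * ((n + 2 : ℕ) : ℝ) ^ 2 *
      (((n + 2 : ℕ) : ℝ) ^ (p + 1))⁻¹ / ((n + 2 : ℕ) : ℝ) ^ (1 - p / 2) =
      ((n + 2 : ℕ) : ℝ) ^ (-(1 / 2) : ℝ) := by
    rw [← Real.rpow_mul hM.le, ← Real.rpow_natCast _ 2, ← Real.rpow_neg hM.le,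
      ← Real.rpow_add hM, ← Real.rpow_add hM, ← Real.rpow_sub hM]
    congr 1
    push_cast
    ring
  calc _ = 2 * Real.Gamma (p + 1) * ((((n + 2 : ℕ) : ℝ) ^ (-(1 / 2) : ℝ)) ^ (1 - p) *
        ((n + 2 : ℕ) : ℝ) ^ 2 / ((n + 2 : ℕ) : ℝ) ^ (1 - p / 2)) * ((n : ℝ) ^ (p + 1))⁻¹ := by
        push_cast
        ring
    _ ≤ 2 * Real.Gamma (p + 1) * ((((n + 2 : ℕ) : ℝ) ^ (-(1 / 2) : ℝ)) ^ (1 - p) *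
        ((n + 2 : ℕ) : ℝ) ^ 2 / ((n + 2 : ℕ) : ℝ) ^ (1 - p / 2)) *
        (3 ^ (p + 1) * (((n + 2 : ℕ) : ℝ) ^ (p + 1))⁻¹) := by
        gcongr
    _ = _ := by
        conv_rhs => rw [← h3]
        ring

lemma tendsto_avgMatching (hp : 1 < p) :
    Tendsto (fun N : ℕ => 2 * avgMatching p N / (N : ℝ) ^ (1 - p / 2)) atTop
      (𝓝 (limitCost p)) := by
  refine (tendsto_exactMatching hp).congr' ?_
  filter_upwards [eventually_ge_atTop 2] with N hN
  rw [avgMatching_eq hp hN]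

lemma tendsto_avgTSP (hp : 1 < p) :
    Tendsto (fun N : ℕ => avgTSP p N / (N : ℝ) ^ (1 - p / 2)) atTop (𝓝 (limitCost p)) := by
  have ht : Tendsto (fun n : ℕ => ((n + 2 : ℕ) : ℝ) ^ (-(1 / 2) : ℝ)) atTop (𝓝 0) :=
    (tendsto_rpow_neg_atTop (by norm_num : (0 : ℝ) < 1 / 2)).comp
      (tendsto_natCast_atTop_atTop.comp (tendsto_add_atTop_nat 2))
  have hA : Tendsto (fun n : ℕ => (1 - ((n + 2 : ℕ) : ℝ) ^ (-(1 / 2) : ℝ)) ^ (1 - p)) atTop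
      (𝓝 1) := by
    have h := (ht.const_sub 1).rpow_const (p := 1 - p) (Or.inl (by norm_num))
    simpa using h
  have hup := (hA.mul ((tendsto_exactMatching hp).comp (tendsto_add_atTop_nat 2))).add
    (tendsto_gap_bound hp)
  rw [one_mul, add_zero] at hup
  rw [← tendsto_add_atTop_iff_nat 2]
  refine tendsto_of_tendsto_of_tendsto_of_le_of_le'
    ((tendsto_avgMatching hp).comp (tendsto_add_atTop_nat 2)) hup ?_ ?_
  · refine Eventually.of_forall fun n => ?_
    simp only [Function.comp_apply]
    gcongr
    exact (two_mul_avgMatching_le hp (by omega)).trans (avgTwoMatching_le hp (by omega))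
  · filter_upwards [eventually_gt_atTop 0] with n hn
    have hM : (1 : ℝ) < ((n + 2 : ℕ) : ℝ) := by exact_mod_cast (by omega : 1 < n + 2)
    simp only [Function.comp_apply]
    rw [← mul_div_assoc, ← add_div]
    gcongr
    exact avgTSP_le hp hn (by positivity) (Real.rpow_lt_one_of_one_lt_of_neg hM (by norm_num))

lemma tendsto_avgTwoMatching (hp : 1 < p) :
    Tendsto (fun N : ℕ => avgTwoMatching p N / (N : ℝ) ^ (1 - p / 2)) atTop
      (𝓝 (limitCost p)) := by
  refine tendsto_of_tendsto_of_tendsto_of_le_of_le' (tendsto_avgMatching hp) (tendsto_avgTSP hp)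
    ?_ ?_
  · filter_upwards [eventually_ge_atTop 2] with N hN
    gcongr
    exact two_mul_avgMatching_le hp hN
  · filter_upwards [eventually_ge_atTop 2] with N hN
    gcongr
    exact avgTwoMatching_le hp hN

end TwoMatching

end

theorem mainTheorem8 :
    -- the optima exist, and the sandwich holds, for every choice of the weights on `K_{N,N}`
    (∀ (N : ℕ), 2 ≤ N → ∀ w : Sym2 (TwoMatching.Vertex N) → ℝ,
      IsLeast (TwoMatching.factorCosts 1 (TwoMatching.K N) w)
        (TwoMatching.matchingCost (TwoMatching.K N) w) ∧
      IsLeast (TwoMatching.factorCosts 2 (TwoMatching.K N) w)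
        (TwoMatching.twoMatchingCost (TwoMatching.K N) w) ∧
      IsLeast (TwoMatching.hamiltonianCosts (TwoMatching.K N) w)
        (TwoMatching.tspCost (TwoMatching.K N) w) ∧
      TwoMatching.tspCost (TwoMatching.K N) w ≥ TwoMatching.twoMatchingCost (TwoMatching.K N) w ∧
      TwoMatching.twoMatchingCost (TwoMatching.K N) w ≥
        2 * TwoMatching.matchingCost (TwoMatching.K N) w) ∧
    -- the optimal costs of the random points have finite averages
    (∀ (p : ℝ), 1 < p → ∀ (N : ℕ), 2 ≤ N →
      Integrable (fun x => TwoMatching.matchingCost (TwoMatching.K N) (TwoMatching.weight p x))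
        (TwoMatching.law N) ∧
      Integrable (fun x => TwoMatching.twoMatchingCost (TwoMatching.K N) (TwoMatching.weight p x))
        (TwoMatching.law N) ∧
      Integrable (fun x => TwoMatching.tspCost (TwoMatching.K N) (TwoMatching.weight p x))
        (TwoMatching.law N)) ∧
    -- the three averages have the scale `N ^ (1 - p / 2)`, with the same limit
    (∀ (p : ℝ), 1 < p → ∃ c : ℝ, 0 < c ∧
      Tendsto (fun N : ℕ => TwoMatching.avgTwoMatching p N / (N : ℝ) ^ (1 - p / 2)) atTop (𝓝 c) ∧
      Tendsto (fun N : ℕ => 2 * TwoMatching.avgMatching p N / (N : ℝ) ^ (1 - p / 2))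
        atTop (𝓝 c) ∧
      Tendsto (fun N : ℕ => TwoMatching.avgTSP p N / (N : ℝ) ^ (1 - p / 2)) atTop (𝓝 c)) ∧
    -- for `p = 2` the limit is `2 / 3`
    Tendsto (fun N : ℕ => TwoMatching.avgTwoMatching 2 N) atTop (𝓝 (2 / 3)) := by
  refine ⟨fun N hN w => ⟨TwoMatching.isLeast_matchingCost w,
      TwoMatching.isLeast_twoMatchingCost hN w,
      TwoMatching.isLeast_tspCost hN w, TwoMatching.twoMatchingCost_le_tspCost hN w,
      TwoMatching.two_mul_matchingCost_le hN w⟩,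
    fun p hp N hN => ⟨TwoMatching.integrable_matchingCost (by linarith),
      TwoMatching.integrable_twoMatchingCost (by linarith) hN,
      TwoMatching.integrable_tspCost (by linarith) hN⟩,
    fun p hp => ⟨TwoMatching.limitCost p, TwoMatching.limitCost_pos hp,
      TwoMatching.tendsto_avgTwoMatching hp, TwoMatching.tendsto_avgMatching hp,
      TwoMatching.tendsto_avgTSP hp⟩, ?_⟩
  have h := TwoMatching.tendsto_avgTwoMatching (p := 2) (by norm_num)
  have hlim : TwoMatching.limitCost 2 = 2 / 3 := by
    norm_num [TwoMatching.limitCost]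
  -- For `p = 2` the scale `N ^ (1 - p / 2)` is 1.
  simpa [hlim] using h
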